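/- Let $q>1$ be a real number and let $m$ be a positive integer. Let $$Y^m(q)=\Big\{\sum_{i=0}^n s_iq^i : n\ge 0,\ s_i\in\{-m,\dots,-1,0,1,\dots,m\}\Big\}$$ be the $m$-spectrum of $q$, that is, the set of values $p(q)$ where $p$ runs over the polynomials with integer coefficients all of whose coefficients have absolute value at most $m$. A Pisot number is a real algebraic integer greater than $1$ all of whose other conjugates (the other complex roots of its minimal polynomial over $\mathbb{Q}$) have modulus strictly less than $1$. Then $Y^m(q)$ has no accumulation point in $\mathbb{R}$ if and only if $q$ is a Pisot number or $q\ge m+1$. -/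

import Mathlib

open Polynomial

/-- A Pisot number: a real algebraic integer greater than `1` all of whose other conjugates
(the complex roots of its minimal polynomial over `ℚ`, other than itself) have modulus strictly
less than `1`. -/
def IsPisot (q : ℝ) : Prop :=
  1 < q ∧ IsIntegral ℤ q ∧
    ∀ z : ℂ, aeval z (minpoly ℚ q) = 0 → z ≠ (q : ℂ) → ‖z‖ < 1

/-- The polynomial `p` has height at most `m`: every coefficient has modulus at most `m`. -/
def HeightLE (m : ℕ) (p : ℤ[X]) : Prop :=
  ∀ i : ℕ, |p.coeff i| ≤ (m : ℤ)

/-- The `m`-spectrum of `q`: the set of all values at `q` of integer polynomials of height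
at most `m`. -/
def mSpectrum (m : ℕ) (q : ℝ) : Set ℝ :=
  {y : ℝ | ∃ p : ℤ[X], HeightLE m p ∧ aeval q p = y}

/-!
Write `Y` for the `m`-spectrum of `q`, and call it locally finite if it meets every bounded interval
in a finite set; this is the same as having no accumulation point. For a Pisot number, the elements
of `Y` in a bounded interval are algebraic integers of `ℚ(q)` all of whose conjugates are bounded,
so there are finitely many (`finite_mSpectrum_inter_of_isPisot`). For `q > m + 1` a polynomial of
height `m` is large at `q` unless its degree is small, and for `q = m + 1` all values are integers
(`finite_mSpectrum_inter_of_add_one_le`).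

Conversely let `Y` be locally finite and `q < m + 1`. Lowering `m` to `⌊q⌋` shrinks `Y`, and
integers are Pisot numbers, so `m < q < m + 1` may be assumed. By the pigeonhole principle `q` is an
algebraic integer (`isIntegral_of_finite`). Let `z` be a conjugate of `q` with `|z| ≥ 1`, and let
`σ : ℤ[q] → ℤ[z]` be the conjugation. Supposing `z ≠ q`, a contradiction arises in four steps
(`eq_of_finite_of_sameRoots`).

* The relation `f (q x - a) = z f x - a`, for `0 ≤ a ≤ m`, has a solution on
  `[0, m / (q - 1)]` which is the distributional derivative of a bounded function `Φ`
  (`exists_selfSimilar_primitive`).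
* Consider the slopes of `x ↦ Φ (x + d) - Φ x - σ(d) x` for `d ∈ Y`. One digit step replaces `d` by
  another element of `Y` and multiplies slopes by `z`. Local finiteness provides a finite grid that
  is closed under these steps. The slopes of maximal modulus between grid points would be permuted
  by the multiplication by `z`, which is not a root of unity; hence they are `0`, and contraction
  carries this over to all points (`IsGrid.shiftDefect_eq`, `IsGrid.shiftDefect_eq_of_mem`).
  Averaging `f` over intervals of a fixed length gives a bounded function `F` on `[0, 1]` with
  `F (r + d) = F r + σ(d)` for all `d ∈ Y` (`exists_bounded_of_finite`).
* The shift by `ε = m + 1 - q` is exact in the same sense (`shiftsBy_add_one_sub`). Let `b` be the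
  least of `ε` and of the `v ∈ (0, 1)` with `v, v - 1 ∈ Y`. Let `X` be the set of values at `q` of
  polynomials with coefficients in `{0, …, m}`. Its gaps are at most `1`, and a gap larger than
  `1 - b` equals `1` (`eq_add_one_of_consecutive`). Hence `G (x + r) = σ(x) + F r`, for `x ∈ X`
  and `r ∈ [0, 1]`, defines a function on `[0, ∞)` with `G (t + b) = G t + σ(b)`
  (`exists_extension`).
* So `G` is linear up to a bounded error along the multiples of `b`, while `G (q ^ N) - z ^ N` is
  bounded. This gives `z ^ N = λ q ^ N + O(1)` with `λ = σ(b) / b ≠ 0`, which forces `z = q`.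
-/

/-! ### The spectrum and its nonnegative part -/

theorem heightLE_X_mul_add_C {m : ℕ} {p : ℤ[X]} (hp : HeightLE m p) {s : ℤ} (hs : |s| ≤ m) :
    HeightLE m (X * p + C s) := by
  intro i
  rcases i with _ | i
  · simpa using hs
  · rw [coeff_add, coeff_X_mul, coeff_C_succ, add_zero]
    exact hp i

theorem mSpectrum_mul_add {m : ℕ} {q y : ℝ} (hy : y ∈ mSpectrum m q) {s : ℤ} (hs : |s| ≤ m) :
    q * y + s ∈ mSpectrum m q := by
  obtain ⟨p, hp, rfl⟩ := hy
  exact ⟨X * p + C s, heightLE_X_mul_add_C hp hs, by simp⟩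

theorem zero_mem_mSpectrum (m : ℕ) (q : ℝ) : (0 : ℝ) ∈ mSpectrum m q :=
  ⟨0, fun i => by simp, by simp⟩

theorem intCast_mem_mSpectrum {m : ℕ} (q : ℝ) {s : ℤ} (hs : |s| ≤ m) :
    (s : ℝ) ∈ mSpectrum m q := by
  simpa using mSpectrum_mul_add (zero_mem_mSpectrum m q) hs

theorem one_mem_mSpectrum {m : ℕ} (hm : 1 ≤ m) (q : ℝ) : (1 : ℝ) ∈ mSpectrum m q := by
  simpa using intCast_mem_mSpectrum q (s := 1) (m := m) (by simpa using hm)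

theorem neg_mem_mSpectrum {m : ℕ} {q y : ℝ} (hy : y ∈ mSpectrum m q) :
    -y ∈ mSpectrum m q := by
  obtain ⟨p, hp, rfl⟩ := hy
  exact ⟨-p, fun i => by simpa using hp i, by simp⟩

theorem mSpectrum_mono {m n : ℕ} (h : m ≤ n) (q : ℝ) : mSpectrum m q ⊆ mSpectrum n q := by
  rintro _ ⟨p, hp, rfl⟩
  exact ⟨p, fun i => (hp i).trans (by exact_mod_cast h), rfl⟩

/-- The values at `q` of the polynomials with all coefficients in `{0, …, m}`. -/
def posSpectrum (m : ℕ) (q : ℝ) : Set ℝ :=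
  {x : ℝ | ∃ p : ℤ[X], (∀ i, 0 ≤ p.coeff i ∧ p.coeff i ≤ m) ∧ aeval q p = x}

theorem zero_mem_posSpectrum (m : ℕ) (q : ℝ) : (0 : ℝ) ∈ posSpectrum m q :=
  ⟨0, fun i => by simp, by simp⟩

theorem posSpectrum_mul_add {m : ℕ} {q x : ℝ} (hx : x ∈ posSpectrum m q) {a : ℕ} (ha : a ≤ m) :
    q * x + a ∈ posSpectrum m q := by
  obtain ⟨p, hp, rfl⟩ := hx
  refine ⟨X * p + C (a : ℤ), fun i => ?_, by simp⟩
  rcases i with _ | i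
  · simpa using ha
  · rw [coeff_add, coeff_X_mul, coeff_C_succ, add_zero]
    exact hp i

theorem exists_eq_mul_add_of_mem_posSpectrum {m : ℕ} {q x : ℝ} (hx : x ∈ posSpectrum m q) :
    ∃ y ∈ posSpectrum m q, ∃ a : ℕ, a ≤ m ∧ x = q * y + a := by
  obtain ⟨p, hp, rfl⟩ := hx
  obtain ⟨h0, h1⟩ := hp 0
  refine ⟨aeval q p.divX, ⟨p.divX, fun i => by simpa using hp (i + 1), rfl⟩,
    (p.coeff 0).toNat, by omega, ?_⟩
  conv_lhs => rw [← X_mul_divX_add p]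
  have : (((p.coeff 0).toNat : ℤ) : ℝ) = (p.coeff 0 : ℝ) := by
    rw [Int.toNat_of_nonneg h0]
  have h2 : ((p.coeff 0).toNat : ℝ) = (p.coeff 0 : ℝ) := by exact_mod_cast this
  rw [map_add, map_mul, aeval_X, aeval_C, h2, eq_intCast]

theorem sub_mem_mSpectrum {m : ℕ} {q x y : ℝ} (hx : x ∈ posSpectrum m q)
    (hy : y ∈ posSpectrum m q) : x - y ∈ mSpectrum m q := by
  obtain ⟨p, hp, rfl⟩ := hx
  obtain ⟨r, hr, rfl⟩ := hy
  refine ⟨p - r, fun i => ?_, by simp⟩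
  have h1 := hp i
  have h2 := hr i
  rw [coeff_sub, abs_le]
  constructor <;> omega

theorem posSpectrum_subset {m : ℕ} {q : ℝ} : posSpectrum m q ⊆ mSpectrum m q := fun x hx => by
  simpa using sub_mem_mSpectrum hx (zero_mem_posSpectrum m q)

theorem posSpectrum_nonneg {m : ℕ} {q x : ℝ} (hq : 0 ≤ q) (hx : x ∈ posSpectrum m q) :
    0 ≤ x := by
  obtain ⟨p, hp, rfl⟩ := hx
  rw [aeval_eq_sum_range]
  refine Finset.sum_nonneg fun i _ => ?_
  have : (0 : ℝ) ≤ p.coeff i := by exact_mod_cast (hp i).1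
  rw [zsmul_eq_mul]
  positivity

theorem pow_mem_posSpectrum {m : ℕ} (hm : 1 ≤ m) (q : ℝ) (n : ℕ) : q ^ n ∈ posSpectrum m q := by
  induction n with
  | zero => simpa using posSpectrum_mul_add (zero_mem_posSpectrum m q) hm
  | succ n ih => simpa [pow_succ'] using posSpectrum_mul_add ih (Nat.zero_le m)

/-- Every `t ≥ 0` lies in `[x, x + 1)` for some `x` in the nonnegative spectrum. -/
theorem exists_posSpectrum_le_lt {m : ℕ} {q : ℝ} (hq : 1 < q) (hqm : q < m + 1) {t : ℝ}
    (ht : 0 ≤ t) : ∃ x ∈ posSpectrum m q, x ≤ t ∧ t < x + 1 := by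
  obtain ⟨n, hn⟩ := pow_unbounded_of_one_lt t hq
  induction n generalizing t with
  | zero => exact ⟨0, zero_mem_posSpectrum m q, ht, by simpa using hn⟩
  | succ n ih =>
    have hq0 : 0 < q := by linarith
    obtain ⟨y, hy, h1, h2⟩ := ih (t := t / q) (by positivity)
      (by rw [div_lt_iff₀ hq0]; simpa [pow_succ] using hn)
    rw [le_div_iff₀ hq0] at h1
    rw [div_lt_iff₀ hq0] at h2
    have h3 : 0 ≤ t - q * y := by nlinarith
    refine ⟨q * y + (min m ⌊t - q * y⌋₊ : ℕ),
      posSpectrum_mul_add hy (min_le_left _ _), ?_, ?_⟩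
    · have h4 := Nat.floor_le h3
      have h5 : ((min m ⌊t - q * y⌋₊ : ℕ) : ℝ) ≤ (⌊t - q * y⌋₊ : ℕ) := by
        exact_mod_cast min_le_right _ _
      linarith
    · rcases min_choice m ⌊t - q * y⌋₊ with h | h
      · rw [h]; nlinarith
      · rw [h]
        have := Nat.lt_floor_add_one (t - q * y)
        linarith

/-- Every positive element of the nonnegative spectrum exceeds another one by at most `1`. -/
theorem exists_posSpectrum_pred {m : ℕ} {q : ℝ} (hq : 1 < q) (hqm : q < m + 1) {x : ℝ}
    (hx : x ∈ posSpectrum m q) (hx0 : 0 < x) : ∃ y ∈ posSpectrum m q, x - 1 ≤ y ∧ y < x := by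
  obtain ⟨n, hn⟩ := pow_unbounded_of_one_lt x hq
  induction n generalizing x with
  | zero => exact ⟨0, zero_mem_posSpectrum m q, by linarith [show x < 1 by simpa using hn], hx0⟩
  | succ n ih =>
    have hq0 : 0 < q := by linarith
    obtain ⟨y, hy, a, ha, rfl⟩ := exists_eq_mul_add_of_mem_posSpectrum hx
    rcases a with _ | a
    · simp only [Nat.cast_zero, add_zero] at *
      have hy0 : 0 < y := pos_of_mul_pos_right hx0 hq0.le
      obtain ⟨w, hw, h1, h2⟩ := ih hy hy0
        (by rw [pow_succ'] at hn; exact lt_of_mul_lt_mul_left hn hq0.le)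
      have h3 : 0 < q * y - q * w := by nlinarith
      have h4 : 0 < ⌈q * y - q * w⌉₊ := Nat.ceil_pos.2 h3
      have h5 := Nat.ceil_lt_add_one h3.le
      have h6 := Nat.le_ceil (q * y - q * w)
      have h7 : ⌈q * y - q * w⌉₊ ≤ m + 1 := Nat.ceil_le.2 (by push_cast; nlinarith)
      obtain ⟨k, hk⟩ := Nat.exists_eq_succ_of_ne_zero h4.ne'
      rw [hk] at h5 h6 h7
      push_cast at h5 h6
      exact ⟨q * w + k, posSpectrum_mul_add hw (by omega), by linarith, by linarith⟩
    · exact ⟨q * y + a, posSpectrum_mul_add hy (by omega), by push_cast; linarith,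
        by push_cast; linarith⟩

/-! ### Conjugation -/

/-- The conjugation `ℤ[q] → ℤ[z]`, `p(q) ↦ p(z)`, as a function on `ℝ`; it is meaningful when `q`
and `z` are roots of the same integer polynomials, and its values outside `ℤ[q]` are irrelevant. -/
noncomputable def conjMap (q : ℝ) (z : ℂ) (y : ℝ) : ℂ :=
  open Classical in if h : ∃ p : ℤ[X], aeval q p = y then aeval z h.choose else 0

/-- `q` and `z` are roots of the same integer polynomials. -/
def SameRoots (q : ℝ) (z : ℂ) : Prop :=
  ∀ p : ℤ[X], aeval q p = 0 ↔ aeval z p = 0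

theorem conjMap_aeval {q : ℝ} {z : ℂ} (h : SameRoots q z) (p : ℤ[X]) :
    conjMap q z (aeval q p) = aeval z p := by
  have hex : ∃ r : ℤ[X], aeval q r = aeval q p := ⟨p, rfl⟩
  rw [conjMap, dif_pos hex]
  have := (h (hex.choose - p)).1 (by rw [map_sub, hex.choose_spec, sub_self])
  rwa [map_sub, sub_eq_zero] at this

/-- The ring `ℤ[q]` of all values of integer polynomials at `q`. -/
noncomputable def intRange (q : ℝ) : Subring ℝ := (aeval q : ℤ[X] →ₐ[ℤ] ℝ).range.toSubring

theorem mem_intRange {q y : ℝ} : y ∈ intRange q ↔ ∃ p : ℤ[X], aeval q p = y := Iff.rfl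

theorem self_mem_intRange (q : ℝ) : q ∈ intRange q := ⟨X, by simp⟩

theorem mSpectrum_subset_intRange {m : ℕ} {q : ℝ} : ∀ y ∈ mSpectrum m q, y ∈ intRange q := by
  rintro _ ⟨p, -, rfl⟩
  exact ⟨p, rfl⟩

theorem conjMap_add {q : ℝ} {z : ℂ} (h : SameRoots q z) {x y : ℝ} (hx : x ∈ intRange q)
    (hy : y ∈ intRange q) :
    conjMap q z (x + y) = conjMap q z x + conjMap q z y := by
  obtain ⟨p, rfl⟩ := mem_intRange.1 hx
  obtain ⟨r, rfl⟩ := mem_intRange.1 hy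
  rw [← map_add, conjMap_aeval h, conjMap_aeval h, conjMap_aeval h, map_add]

theorem conjMap_mul {q : ℝ} {z : ℂ} (h : SameRoots q z) {x y : ℝ} (hx : x ∈ intRange q)
    (hy : y ∈ intRange q) :
    conjMap q z (x * y) = conjMap q z x * conjMap q z y := by
  obtain ⟨p, rfl⟩ := mem_intRange.1 hx
  obtain ⟨r, rfl⟩ := mem_intRange.1 hy
  rw [← map_mul, conjMap_aeval h, conjMap_aeval h, conjMap_aeval h, map_mul]

theorem conjMap_intCast {q : ℝ} {z : ℂ} (h : SameRoots q z) (n : ℤ) : conjMap q z n = n := by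
  have := conjMap_aeval h (C n)
  simpa using this

theorem conjMap_one {q : ℝ} {z : ℂ} (h : SameRoots q z) :
    conjMap q z 1 = 1 := by
  simpa using conjMap_intCast h 1

theorem conjMap_zero {q : ℝ} {z : ℂ} (h : SameRoots q z) :
    conjMap q z 0 = 0 := by
  simpa using conjMap_intCast h 0

theorem conjMap_self {q : ℝ} {z : ℂ} (h : SameRoots q z) : conjMap q z q = z := by
  have := conjMap_aeval h X
  simpa using this

theorem conjMap_neg {q : ℝ} {z : ℂ} (h : SameRoots q z) {x : ℝ} (hx : x ∈ intRange q) :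
    conjMap q z (-x) = -conjMap q z x := by
  have := conjMap_add h hx (neg_mem hx)
  rw [add_neg_cancel, conjMap_zero h] at this
  exact (neg_eq_of_add_eq_zero_right this.symm).symm

theorem conjMap_sub {q : ℝ} {z : ℂ} (h : SameRoots q z) {x y : ℝ} (hx : x ∈ intRange q)
    (hy : y ∈ intRange q) :
    conjMap q z (x - y) = conjMap q z x - conjMap q z y := by
  rw [sub_eq_add_neg, conjMap_add h hx (neg_mem hy), conjMap_neg h hy, sub_eq_add_neg]

theorem conjMap_mul_add {q : ℝ} {z : ℂ} (h : SameRoots q z) {x : ℝ} (hx : x ∈ intRange q) (n : ℤ) :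
    conjMap q z (q * x + n) = z * conjMap q z x + n := by
  rw [conjMap_add h (mul_mem (self_mem_intRange q) hx) (intCast_mem _ n),
    conjMap_mul h (self_mem_intRange q) hx, conjMap_self h, conjMap_intCast h]

theorem conjMap_pow {q : ℝ} {z : ℂ} (h : SameRoots q z) (n : ℕ) : conjMap q z (q ^ n) = z ^ n := by
  have := conjMap_aeval h (X ^ n)
  simpa using this

theorem conjMap_ne_zero {q : ℝ} {z : ℂ} (h : SameRoots q z) {x : ℝ} (hx : x ∈ intRange q)
    (h0 : x ≠ 0) :
    conjMap q z x ≠ 0 := by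
  obtain ⟨p, rfl⟩ := mem_intRange.1 hx
  rw [conjMap_aeval h]
  exact fun h1 => h0 ((h p).2 h1)

theorem pow_ne_one_of_sameRoots {q : ℝ} {z : ℂ} (h : SameRoots q z) (hq : 1 < q) {n : ℕ}
    (hn : n ≠ 0) :
    z ^ n ≠ 1 := by
  intro h1
  have := (h (X ^ n - 1)).2 (by simp [h1])
  simp only [map_sub, map_pow, aeval_X, map_one, sub_eq_zero] at this
  exact (one_lt_pow₀ hq hn).ne' this

/-! ### Local finiteness, and the two cases in which it holds -/

theorem finite_inter_Icc_of_not_accPt {Y : Set ℝ}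
    (h : ¬ ∃ x : ℝ, AccPt x (Filter.principal Y)) (R : ℝ) : (Y ∩ Set.Icc (-R) R).Finite := by
  by_contra hinf
  obtain ⟨x, -, hx⟩ := Set.Infinite.exists_accPt_of_subset_isCompact hinf
    (isCompact_Icc (a := -R) (b := R)) Set.inter_subset_right
  exact h ⟨x, hx.mono (Filter.principal_mono.2 Set.inter_subset_left)⟩

theorem not_accPt_of_finite_inter_Icc {Y : Set ℝ}
    (h : ∀ R : ℝ, (Y ∩ Set.Icc (-R) R).Finite) :
    ¬ ∃ x : ℝ, AccPt x (Filter.principal Y) := by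
  rintro ⟨x, hx⟩
  have hmem : Set.Icc (-(|x| + 1)) (|x| + 1) ∈ nhds x := by
    refine Icc_mem_nhds ?_ ?_
    · linarith [neg_abs_le x]
    · linarith [le_abs_self x]
  have h2 : AccPt x (Filter.principal (Y ∩ Set.Icc (-(|x| + 1)) (|x| + 1))) := by
    rw [accPt_iff_nhds] at hx ⊢
    intro U hU
    obtain ⟨y, ⟨⟨hyU, hyI⟩, hyY⟩, hne⟩ := hx _ (Filter.inter_mem hU hmem)
    exact ⟨y, ⟨hyU, hyY, hyI⟩, hne⟩
  exact Set.Infinite.of_accPt h2 (h _)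

theorem finite_values_natDegree_lt (m : ℕ) (q : ℝ) (n : ℕ) :
    {y : ℝ | ∃ p : ℤ[X], HeightLE m p ∧ p.natDegree < n ∧ aeval q p = y}.Finite := by
  induction n with
  | zero => simp
  | succ n ih =>
    refine ((ih.insert 0).image2 (fun y (s : ℤ) => q * y + s)
      (Set.finite_Icc (-(m : ℤ)) m)).subset ?_
    rintro _ ⟨p, hp, hd, rfl⟩
    refine ⟨aeval q p.divX, ?_, p.coeff 0, abs_le.1 (hp 0), ?_⟩
    · rcases eq_or_ne p.natDegree 0 with h0 | h0
      · left
        rw [eq_C_of_natDegree_eq_zero h0, divX_C, map_zero]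
      · right
        refine ⟨p.divX, fun i => by simpa using hp (i + 1), ?_, rfl⟩
        rw [natDegree_divX_eq_natDegree_tsub_one]
        omega
    · conv_rhs => rw [← X_mul_divX_add p]
      simp

/-- At `q > m + 1`, a polynomial of height at most `m` and degree `n` is of order at least
`q ^ n`. -/
theorem le_abs_aeval_of_height {m : ℕ} {q : ℝ} (hm : 1 ≤ m) (hq : (m : ℝ) + 1 < q) (n : ℕ) :
    ∀ p : ℤ[X], HeightLE m p → p.natDegree = n → p ≠ 0 →
      (1 - m / (q - 1)) * q ^ n + m / (q - 1) ≤ |aeval q p| := by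
  have hm' : (1 : ℝ) ≤ m := by exact_mod_cast hm
  induction n with
  | zero =>
    intro p hp hd h0
    rw [eq_C_of_natDegree_eq_zero hd] at h0 ⊢
    have : p.coeff 0 ≠ 0 := fun h => h0 (by rw [h, C_0])
    have : (1 : ℤ) ≤ |p.coeff 0| := Int.one_le_abs this
    have : (1 : ℝ) ≤ |(p.coeff 0 : ℝ)| := by exact_mod_cast this
    simpa using this
  | succ n ih =>
    intro p hp hd h0
    have h1 := ih p.divX (fun i => by simpa using hp (i + 1))
      (by rw [natDegree_divX_eq_natDegree_tsub_one]; omega)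
      (fun h => by
        have := natDegree_divX_eq_natDegree_tsub_one (p := p)
        have h2 := X_mul_divX_add p
        rw [h, mul_zero, zero_add] at h2
        rw [← h2, natDegree_C] at hd
        omega)
    have h2 : aeval q p = q * aeval q p.divX + (p.coeff 0 : ℝ) := by
      conv_lhs => rw [← X_mul_divX_add p]
      simp
    have h3 : |(p.coeff 0 : ℝ)| ≤ m := by exact_mod_cast hp 0
    have h4 : |q * aeval q p.divX| ≤ |aeval q p| + |(p.coeff 0 : ℝ)| := by
      have := abs_sub (aeval q p) (p.coeff 0 : ℝ)
      rwa [h2, add_sub_cancel_right, ← h2] at this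
    rw [abs_mul, abs_of_pos (by linarith : (0 : ℝ) < q)] at h4
    have h5 : q * ((1 - m / (q - 1)) * q ^ n + m / (q - 1)) ≤ q * |aeval q p.divX| :=
      mul_le_mul_of_nonneg_left h1 (by linarith)
    have h6 : q * (m / (q - 1)) = m + m / (q - 1) := by
      field_simp [show q - 1 ≠ 0 by linarith]
      ring
    calc (1 - m / (q - 1)) * q ^ (n + 1) + m / (q - 1)
        = q * ((1 - m / (q - 1)) * q ^ n + m / (q - 1)) - m := by rw [mul_add, h6]; ring
      _ ≤ _ := by linarith

theorem finite_mSpectrum_inter_of_add_one_le {m : ℕ} {q : ℝ} (hm : 1 ≤ m)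
    (hq : (m : ℝ) + 1 ≤ q) (R : ℝ) : (mSpectrum m q ∩ Set.Icc (-R) R).Finite := by
  have hm' : (1 : ℝ) ≤ m := by exact_mod_cast hm
  rcases hq.eq_or_lt with hq | hq
  · refine ((Set.finite_Icc ⌈-R⌉ ⌊R⌋).image (fun n : ℤ => (n : ℝ))).subset ?_
    rintro _ ⟨⟨p, -, rfl⟩, h1, h2⟩
    have : aeval q p = ((p.eval ((m : ℤ) + 1) : ℤ) : ℝ) := by
      rw [← hq, show (m : ℝ) + 1 = (((m : ℤ) + 1 : ℤ) : ℝ) by push_cast; ring,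
        ← eq_intCast (algebraMap ℤ ℝ), aeval_algebraMap_apply]
      simp
    rw [this] at h1 h2 ⊢
    exact ⟨_, ⟨Int.ceil_le.2 h1, Int.le_floor.2 h2⟩, rfl⟩
  · have hc : 0 < 1 - m / (q - 1) := by
      rw [sub_pos, div_lt_one (by linarith)]
      linarith
    have hk : 0 < m / (q - 1) := by
      have : 0 < q - 1 := by linarith
      positivity
    obtain ⟨n, hn⟩ := pow_unbounded_of_one_lt (R / (1 - m / (q - 1))) (by linarith : 1 < q)
    refine (finite_values_natDegree_lt m q (n + 1)).subset ?_
    rintro _ ⟨⟨p, hp, rfl⟩, hR⟩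
    refine ⟨p, hp, ?_, rfl⟩
    by_contra hd
    have h0 : p ≠ 0 := by
      rintro rfl
      simp at hd
    have h1 := le_abs_aeval_of_height hm hq _ p hp rfl h0
    have h2 : q ^ n ≤ q ^ p.natDegree := pow_le_pow_right₀ (by linarith) (by omega)
    rw [div_lt_iff₀ hc] at hn
    have h3 := abs_le.2 hR
    nlinarith

theorem norm_aeval_le_of_height {m : ℕ} {p : ℤ[X]} (hp : HeightLE m p) {w : ℂ} (hw : ‖w‖ < 1) :
    ‖aeval w p‖ ≤ m / (1 - ‖w‖) := by
  rw [aeval_eq_sum_range]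
  calc ‖∑ i ∈ Finset.range (p.natDegree + 1), p.coeff i • w ^ i‖
      ≤ ∑ i ∈ Finset.range (p.natDegree + 1), ‖p.coeff i • w ^ i‖ := norm_sum_le _ _
    _ ≤ ∑ i ∈ Finset.range (p.natDegree + 1), m * ‖w‖ ^ i := by
        refine Finset.sum_le_sum fun i _ => ?_
        rw [zsmul_eq_mul, norm_mul, norm_pow, Complex.norm_intCast]
        gcongr
        exact_mod_cast hp i
    _ = m * ∑ i ∈ Finset.range (p.natDegree + 1), ‖w‖ ^ i := by rw [Finset.mul_sum]
    _ ≤ m * (1 - ‖w‖)⁻¹ := by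
        gcongr
        rw [← tsum_geometric_of_lt_one (norm_nonneg w) hw]
        exact (summable_geometric_of_lt_one (norm_nonneg w) hw).sum_le_tsum _
          fun i _ => by positivity
    _ = _ := by rw [div_eq_mul_inv]

open IntermediateField in
theorem finite_mSpectrum_inter_of_isPisot {m : ℕ} {q : ℝ} (hq : IsPisot q) (R : ℝ) :
    (mSpectrum m q ∩ Set.Icc (-R) R).Finite := by
  obtain ⟨hq1, hint, hconj⟩ := hq
  have hintQ : IsIntegral ℚ q := hint.tower_top
  have : FiniteDimensional ℚ ℚ⟮q⟯ := adjoin.finiteDimensional hintQ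
  have : NumberField ℚ⟮q⟯ := { to_charZero := inferInstance, to_finiteDimensional := this }
  set g : ℚ⟮q⟯ := AdjoinSimple.gen ℚ q with hg
  have hgq : algebraMap ℚ⟮q⟯ ℝ g = q := AdjoinSimple.algebraMap_gen ℚ q
  have hgint : IsIntegral ℤ g := by
    refine (isIntegral_algebraMap_iff (A := ℚ⟮q⟯) (B := ℝ)
      (FaithfulSMul.algebraMap_injective _ _)).1 ?_
    rwa [hgq]
  have hroot : ∀ φ : ℚ⟮q⟯ →+* ℂ, aeval (φ g) (minpoly ℚ q) = 0 := by
    intro φ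
    have h1 : aeval g (minpoly ℚ q) = 0 := by
      apply FaithfulSMul.algebraMap_injective ℚ⟮q⟯ ℝ
      rw [← aeval_algebraMap_apply, hgq, minpoly.aeval, map_zero]
    have h2 := aeval_algHom_apply φ.toRatAlgHom g (minpoly ℚ q)
    rw [h1, map_zero] at h2
    exact h2
  classical
  set B : (ℚ⟮q⟯ →+* ℂ) → ℝ := fun φ => if φ g = q then |R| else m / (1 - ‖φ g‖) with hB
  have hB0 : ∀ φ, 0 ≤ B φ := by
    intro φ
    simp only [hB]
    split_ifs with h
    · exact abs_nonneg R
    · have := hconj (φ g) (hroot φ) h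
      have : 0 < 1 - ‖φ g‖ := by linarith
      positivity
  refine ((NumberField.Embeddings.finite_of_norm_le ℚ⟮q⟯ ℂ (∑ φ, B φ)).image
    (algebraMap ℚ⟮q⟯ ℝ)).subset ?_
  rintro _ ⟨⟨p, hp, rfl⟩, hR⟩
  refine ⟨aeval g p, ⟨?_, fun φ => ?_⟩, by rw [← aeval_algebraMap_apply, hgq]⟩
  · exact adjoin_le_integralClosure hgint (aeval_mem_adjoin_singleton ℤ g)
  · refine le_trans ?_ (Finset.single_le_sum (fun φ _ => hB0 φ) (Finset.mem_univ φ))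
    have h2 : φ (aeval g p) = aeval (φ g) p := (aeval_algHom_apply φ.toIntAlgHom g p).symm
    rw [h2]
    simp only [hB]
    split_ifs with h
    · have h3 : aeval (q : ℂ) p = ((aeval q p : ℝ) : ℂ) :=
        aeval_algebraMap_apply ℂ q p
      rw [h, h3, Complex.norm_real]
      exact (abs_le.2 hR).trans (le_abs_self R)
    · exact norm_aeval_le_of_height hp (hconj (φ g) (hroot φ) h)

/-! ### A self-similar primitive -/

/-- If a nonnegative series keeps its sum after being twisted by the powers of a number of modulus
at most `1`, that number is `1`. -/
theorem eq_one_of_hasSum_twist {a : ℕ → ℝ} {w : ℂ} {s : ℝ} (ha : ∀ n, 0 ≤ a n) (h0 : 0 < a 0)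
    (hw : ‖w‖ ≤ 1) (h1 : HasSum a s) (h2 : HasSum (fun n => (a n : ℂ) * w ^ (n + 1)) s) :
    w = 1 := by
  have h3 : HasSum (fun n => a n * (w ^ (n + 1)).re) s := by
    have h := Complex.hasSum_re h2
    simp_rw [Complex.re_ofReal_mul, Complex.ofReal_re] at h
    exact h
  have h4 := h1.sub h3
  rw [sub_self] at h4
  have h5 : ∀ n, (w ^ (n + 1)).re ≤ 1 := fun n =>
    (Complex.re_le_norm _).trans (by rw [norm_pow]; exact pow_le_one₀ (norm_nonneg w) hw)
  have h6 : ∀ n, 0 ≤ a n - a n * (w ^ (n + 1)).re := fun n => by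
    have := mul_le_mul_of_nonneg_left (h5 n) (ha n)
    linarith
  have h6 := congrFun ((hasSum_zero_iff_of_nonneg h6).1 h4) 0
  simp only [zero_add, pow_one, Pi.zero_apply] at h6
  have h7 : w.re = 1 := by
    have : a 0 * (1 - w.re) = 0 := by linarith
    rcases mul_eq_zero.1 this with h | h <;> linarith
  have h8 : w.im = 0 := by
    have h9 := Complex.sq_norm w
    rw [Complex.normSq_apply, h7] at h9
    have : ‖w‖ ^ 2 ≤ 1 := pow_le_one₀ (norm_nonneg w) hw
    nlinarith [mul_self_nonneg w.im]
  exact Complex.ext h7 h8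

/-- The sum of `uⁿ g(Tⁿ x)`, a solution `S` of `S x = g x + u S (T x)`. -/
noncomputable def orbitSum (u : ℂ) (T : ℝ → ℝ) (g : ℝ → ℂ) (x : ℝ) : ℂ :=
  ∑' n : ℕ, u ^ n * g (T^[n] x)

theorem norm_orbitSum_term_le {u : ℂ} {T : ℝ → ℝ} {g : ℝ → ℂ} {J : Set ℝ} {C : ℝ}
    (hT : Set.MapsTo T J J) (hg : ∀ x ∈ J, ‖g x‖ ≤ C) {x : ℝ} (hx : x ∈ J) (n : ℕ) :
    ‖u ^ n * g (T^[n] x)‖ ≤ ‖u‖ ^ n * C := by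
  rw [norm_mul, norm_pow]
  exact mul_le_mul_of_nonneg_left (hg _ (hT.iterate n hx)) (by positivity)

theorem summable_orbitSum {u : ℂ} {T : ℝ → ℝ} {g : ℝ → ℂ} {J : Set ℝ} {C : ℝ} (hu : ‖u‖ < 1)
    (hT : Set.MapsTo T J J) (hg : ∀ x ∈ J, ‖g x‖ ≤ C) {x : ℝ} (hx : x ∈ J) :
    Summable fun n : ℕ => u ^ n * g (T^[n] x) :=
  Summable.of_norm_bounded ((summable_geometric_of_lt_one (norm_nonneg u) hu).mul_right C)
    (norm_orbitSum_term_le hT hg hx)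

theorem orbitSum_eq {u : ℂ} {T : ℝ → ℝ} {g : ℝ → ℂ} {J : Set ℝ} {C : ℝ} (hu : ‖u‖ < 1)
    (hT : Set.MapsTo T J J) (hg : ∀ x ∈ J, ‖g x‖ ≤ C) {x : ℝ} (hx : x ∈ J) :
    orbitSum u T g x = g x + u * orbitSum u T g (T x) := by
  rw [orbitSum, (summable_orbitSum hu hT hg hx).tsum_eq_zero_add, orbitSum, ← tsum_mul_left]
  simp [pow_succ', mul_assoc]

theorem norm_orbitSum_le {u : ℂ} {T : ℝ → ℝ} {g : ℝ → ℂ} {J : Set ℝ} {C : ℝ} (hu : ‖u‖ < 1)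
    (hT : Set.MapsTo T J J) (hg : ∀ x ∈ J, ‖g x‖ ≤ C) {x : ℝ} (hx : x ∈ J) :
    ‖orbitSum u T g x‖ ≤ (1 - ‖u‖)⁻¹ * C :=
  tsum_of_norm_bounded ((hasSum_geometric_of_lt_one (norm_nonneg u) hu).mul_right C)
    (norm_orbitSum_term_le hT hg hx)

/-- The largest digit `a ≤ m` with `a ≤ q x`. -/
noncomputable def greedyDigit (m : ℕ) (q x : ℝ) : ℕ := min m ⌊q * x⌋₊

/-- The remainder `q x - a` left by the greedy digit `a` of `x`. -/
noncomputable def greedyMap (m : ℕ) (q x : ℝ) : ℝ := q * x - greedyDigit m q x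

theorem greedyDigit_le (m : ℕ) (q x : ℝ) : greedyDigit m q x ≤ m := min_le_left _ _

theorem greedyMap_nonneg (m : ℕ) {q x : ℝ} (hq : 0 ≤ q) (hx : 0 ≤ x) : 0 ≤ greedyMap m q x := by
  have h1 := Nat.floor_le (mul_nonneg hq hx)
  have h2 : (greedyDigit m q x : ℝ) ≤ (⌊q * x⌋₊ : ℕ) := by exact_mod_cast min_le_right _ _
  rw [greedyMap]
  linarith

theorem greedyMap_lt_one {m : ℕ} {q x : ℝ} (h : greedyDigit m q x < m) :
    greedyMap m q x < 1 := by
  have h1 : greedyDigit m q x = ⌊q * x⌋₊ := by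
    rw [greedyDigit] at h ⊢
    omega
  rw [greedyMap, h1]
  have := Nat.lt_floor_add_one (q * x)
  linarith

theorem greedyMap_le {m : ℕ} {q x K : ℝ} (hq : 0 ≤ q) (hK : q * K = K + m) (hK1 : 1 ≤ K)
    (hx : x ≤ K) : greedyMap m q x ≤ K := by
  rcases (greedyDigit_le m q x).eq_or_lt with h | h
  · rw [greedyMap, h]
    nlinarith
  · exact (greedyMap_lt_one h).le.trans hK1

theorem greedyMap_mapsTo {m : ℕ} {q K : ℝ} (hq : 0 ≤ q) (hK : q * K = K + m) (hK1 : 1 ≤ K) :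
    Set.MapsTo (greedyMap m q) (Set.Icc 0 K) (Set.Icc 0 K) := fun _ hx =>
  ⟨greedyMap_nonneg m hq hx.1, greedyMap_le hq hK hK1 hx.2⟩

theorem greedyDigit_div {m a : ℕ} {q y : ℝ} (hq : 0 < q) (ha : a ≤ m) (hy : 0 ≤ y)
    (hy1 : a < m → y < 1) : greedyDigit m q ((a + y) / q) = a := by
  have h1 : q * ((a + y) / q) = a + y := by field_simp
  rw [greedyDigit, h1, add_comm, Nat.floor_add_natCast hy]
  rcases ha.eq_or_lt with h | h
  · omega
  · rw [Nat.floor_eq_zero.2 (hy1 h)]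
    omega

theorem hasSum_greedyDigit {m : ℕ} {q K x : ℝ} (hq : 1 < q) (hK : q * K = K + m) (hK1 : 1 ≤ K)
    (hx : x ∈ Set.Icc 0 K) :
    HasSum (fun n => (greedyDigit m q ((greedyMap m q)^[n] x) : ℝ) * (q⁻¹) ^ (n + 1)) x := by
  have hq0 : 0 < q := by linarith
  have hT := greedyMap_mapsTo hq0.le hK hK1
  have hpart : ∀ N, ∑ n ∈ Finset.range N,
      (greedyDigit m q ((greedyMap m q)^[n] x) : ℝ) * (q⁻¹) ^ (n + 1) =
        x - (greedyMap m q)^[N] x * (q⁻¹) ^ N := by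
    intro N
    induction N with
    | zero => simp
    | succ N ih =>
      rw [Finset.sum_range_succ, ih, Function.iterate_succ_apply']
      set y := (greedyMap m q)^[N] x
      rw [greedyMap, pow_succ]
      field_simp
      ring
  rw [hasSum_iff_tendsto_nat_of_nonneg (fun n => by positivity)]
  simp_rw [hpart]
  have h1 : Filter.Tendsto (fun N => K * (q⁻¹) ^ N) Filter.atTop (nhds (K * 0)) :=
    (tendsto_pow_atTop_nhds_zero_of_lt_one (by positivity) (inv_lt_one_of_one_lt₀ hq)).const_mul K
  rw [mul_zero] at h1
  have h2 : Filter.Tendsto (fun N => (greedyMap m q)^[N] x * (q⁻¹) ^ N) Filter.atTop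
      (nhds 0) := by
    refine squeeze_zero (fun N => ?_) (fun N => ?_) h1
    · exact mul_nonneg (hT.iterate N hx).1 (by positivity)
    · exact mul_le_mul_of_nonneg_right (hT.iterate N hx).2 (by positivity)
  simpa using h2.const_sub x

/-- There is a bounded function `Φ` whose derivative `f`, as a distribution on `[0, K]`, is
self-similar: `f (q x - a) = z f x - a` for each digit `a` which `x` admits. It is an orbit sum over
the greedy map. At a point with two admissible digits the pieces have to fit together, which fixes
the value of `Φ` at `1`: this is a linear equation, solvable because `z ≠ 1`. -/
theorem exists_selfSimilar_primitive {m : ℕ} {q K : ℝ} {z : ℂ} (hm : 1 ≤ m) (hq : 1 < q)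
    (hK : q * K = K + m) (hK1 : 1 ≤ K) (hz : 1 ≤ ‖z‖) (hz1 : z ≠ 1) :
    ∃ (Φ : ℝ → ℂ) (φ : ℕ → ℂ) (C : ℝ), (∀ x ∈ Set.Icc 0 K, ‖Φ x‖ ≤ C) ∧
      ∀ a ≤ m, ∀ y ∈ Set.Icc 0 K, (a < m → y ≤ 1) →
        Φ ((a + y) / q) = φ a + (Φ y + a * y) / (q * z) := by
  have hq0 : 0 < q := by linarith
  have hz0 : z ≠ 0 := norm_pos_iff.1 (by linarith)
  have hqC : (q : ℂ) ≠ 0 := by exact_mod_cast hq0.ne'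
  have hT := greedyMap_mapsTo hq0.le hK hK1
  set T := greedyMap m q
  set u : ℂ := ((q : ℂ) * z)⁻¹ with hu
  have hu1 : ‖u‖ < 1 := by
    rw [hu, norm_inv, norm_mul, Complex.norm_real, Real.norm_of_nonneg hq0.le]
    exact inv_lt_one_of_one_lt₀ (by nlinarith)
  -- `φ a = ω β a + α a` solves `φ (a + 1) = φ a + u (ω + a)`, with `ω` the value at `1`.
  set α : ℕ → ℂ := fun a => u * (a * (a - 1) / 2) with hα
  set β : ℕ → ℂ := fun a => u * a with hβ
  set g : ℝ → ℂ := fun x => α (greedyDigit m q x) + u * (greedyDigit m q x * T x) with hg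
  set g' : ℝ → ℂ := fun x => β (greedyDigit m q x) with hg'
  have hbd : ∃ C, ∀ x ∈ Set.Icc 0 K, ‖g x‖ ≤ C := by
    refine ⟨∑ a ∈ Finset.range (m + 1), ‖α a‖ + ‖u‖ * (m * K), fun x hx => ?_⟩
    refine (norm_add_le _ _).trans (add_le_add ?_ ?_)
    · exact Finset.single_le_sum (f := fun a => ‖α a‖) (fun _ _ => norm_nonneg _)
        (Finset.mem_range.2 (Nat.lt_succ_of_le (greedyDigit_le m q x)))
    · rw [norm_mul, norm_mul, Complex.norm_natCast, Complex.norm_real,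
        Real.norm_of_nonneg (hT hx).1]
      have h1 : (greedyDigit m q x : ℝ) ≤ m := by exact_mod_cast greedyDigit_le m q x
      have h2 := (hT hx).2
      have h3 := (hT hx).1
      gcongr
  have hbd' : ∃ C, ∀ x ∈ Set.Icc 0 K, ‖g' x‖ ≤ C := by
    refine ⟨∑ a ∈ Finset.range (m + 1), ‖β a‖, fun x hx => ?_⟩
    exact Finset.single_le_sum (f := fun a => ‖β a‖) (fun _ _ => norm_nonneg _)
        (Finset.mem_range.2 (Nat.lt_succ_of_le (greedyDigit_le m q x)))
  obtain ⟨C, hC⟩ := hbd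
  obtain ⟨C', hC'⟩ := hbd'
  have h1mem : (1 : ℝ) ∈ Set.Icc 0 K := ⟨zero_le_one, hK1⟩
  have h0mem : (0 : ℝ) ∈ Set.Icc 0 K := ⟨le_rfl, by linarith⟩
  have hB1 : orbitSum u T g' 1 ≠ 1 := by
    intro h
    have h1 := (summable_orbitSum hu1 hT hC' h1mem).hasSum
    rw [← orbitSum, h] at h1
    have h2 := hasSum_greedyDigit hq hK hK1 h1mem
    have h3 : z⁻¹ = 1 := by
      refine eq_one_of_hasSum_twist (fun n => by positivity) ?_ ?_ h2 ?_
      · have h4 : 1 ≤ greedyDigit m q 1 := by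
          rw [greedyDigit, mul_one]
          exact le_min hm (Nat.le_floor (by simpa using hq.le))
        have h5 : (0 : ℝ) < greedyDigit m q 1 := by exact_mod_cast h4
        simp only [Function.iterate_zero, id]
        positivity
      · rw [norm_inv]
        exact inv_le_one_of_one_le₀ hz
      · rw [Complex.ofReal_one]
        convert h1 using 2 with n
        simp only [hg', hβ, hu]
        push_cast
        rw [mul_inv, mul_pow, pow_succ, pow_succ]
        ring
    exact hz1 (inv_eq_one.1 h3)
  set ω : ℂ := orbitSum u T g 1 / (1 - orbitSum u T g' 1) with hω
  have hω1 : orbitSum u T g 1 + ω * orbitSum u T g' 1 = ω := by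
    have : (1 : ℂ) - orbitSum u T g' 1 ≠ 0 := sub_ne_zero.2 hB1.symm
    rw [hω]
    field_simp
    ring
  set Φ : ℝ → ℂ := fun x => orbitSum u T g x + ω * orbitSum u T g' x with hΦ
  have hΦeq : ∀ x ∈ Set.Icc 0 K, Φ x = α (greedyDigit m q x) + ω * β (greedyDigit m q x) +
      u * (Φ (T x) + greedyDigit m q x * T x) := by
    intro x hx
    simp only [hΦ]
    rw [orbitSum_eq hu1 hT hC hx, orbitSum_eq hu1 hT hC' hx]
    simp only [hg, hg']
    ring
  have hd0 : greedyDigit m q 0 = 0 := by simp [greedyDigit]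
  have hT0 : T 0 = 0 := by simp [T, greedyMap, hd0]
  have hΦ0 : Φ 0 = 0 := by
    have h := hΦeq 0 h0mem
    rw [hd0, hT0] at h
    simp only [hα, hβ, Nat.cast_zero, zero_mul, mul_zero, zero_div, add_zero, zero_add] at h
    have hne : (1 : ℂ) - u ≠ 0 := by
      intro h1
      rw [← sub_eq_zero.1 h1] at hu1
      simp at hu1
    have : (1 - u) * Φ 0 = 0 := by linear_combination h
    exact (mul_eq_zero.1 this).resolve_left hne
  refine ⟨Φ, fun a => α a + ω * β a, (1 - ‖u‖)⁻¹ * C + ‖ω‖ * ((1 - ‖u‖)⁻¹ * C'),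
    fun x hx => ?_, fun a ha y hy hy1 => ?_⟩
  · refine (norm_add_le _ _).trans (add_le_add (norm_orbitSum_le hu1 hT hC hx) ?_)
    rw [norm_mul]
    exact mul_le_mul_of_nonneg_left (norm_orbitSum_le hu1 hT hC' hx) (norm_nonneg ω)
  · -- The digit jumps to `a + 1` at the right end `y = 1` of a piece with `a < m`.
    have hx : ∀ b ≤ m, ∀ w ∈ Set.Icc 0 K, ((b : ℝ) + w) / q ∈ Set.Icc 0 K := by
      intro b hb w hw
      have hb' : (b : ℝ) ≤ m := by exact_mod_cast hb
      have hw0 := hw.1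
      refine ⟨by positivity, ?_⟩
      rw [div_le_iff₀ hq0]
      linarith [hw.2]
    have key : ∀ b ≤ m, ∀ w ∈ Set.Icc 0 K, (b < m → w < 1) →
        Φ ((b + w) / q) = α b + ω * β b + u * (Φ w + b * w) := by
      intro b hb w hw hw1
      have hdig := greedyDigit_div hq0 hb hw.1 hw1
      have hTw : T ((b + w) / q) = w := by
        simp only [T, greedyMap, hdig]
        field_simp
        ring
      rw [hΦeq _ (hx b hb w hw), hdig, hTw]
    rw [div_eq_inv_mul _ ((q : ℂ) * z), ← hu]
    by_cases hlt : a < m → y < 1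
    · exact key a ha y hy hlt
    · push Not at hlt
      obtain ⟨ham, hy2⟩ := hlt
      have hy3 : y = 1 := le_antisymm (hy1 ham) hy2
      have h2 := key (a + 1) ham 0 h0mem (fun _ => one_pos)
      have hΦ1 : Φ 1 = ω := hω1
      subst hy3
      rw [add_zero, hΦ0] at h2
      push_cast at h2
      rw [h2, hΦ1]
      simp only [hα, hβ]
      push_cast
      ring

/-! ### Rigidity of the primitive under shifts -/

/-- The deviation from the law `Φ (x + d) = Φ x + σ d * x + const`. -/
noncomputable def shiftDefect (Φ σ : ℝ → ℂ) (d x : ℝ) : ℂ := Φ (x + d) - Φ x - σ d * x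

/-- One digit step multiplies the slopes of `shiftDefect` by `z`. -/
theorem shiftDefect_sub {m : ℕ} {q K : ℝ} {z : ℂ} {Φ σ : ℝ → ℂ} {φ : ℕ → ℂ} (hq : 0 < q)
    (hz : z ≠ 0)
    (hΦ : ∀ a ≤ m, ∀ y ∈ Set.Icc 0 K, (a < m → y ≤ 1) →
      Φ ((a + y) / q) = φ a + (Φ y + a * y) / (q * z))
    {a b : ℕ} (ha : a ≤ m) (hb : b ≤ m) {d x₁ x₂ : ℝ}
    (hσ : σ (q * d + a - b) = z * σ d + a - b)
    (h₁ : q * x₁ - a ∈ Set.Icc 0 K ∧ (a < m → q * x₁ - a ≤ 1))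
    (h₂ : q * x₂ - a ∈ Set.Icc 0 K ∧ (a < m → q * x₂ - a ≤ 1))
    (h₁' : q * (x₁ + d) - b ∈ Set.Icc 0 K ∧ (b < m → q * (x₁ + d) - b ≤ 1))
    (h₂' : q * (x₂ + d) - b ∈ Set.Icc 0 K ∧ (b < m → q * (x₂ + d) - b ≤ 1)) :
    shiftDefect Φ σ d x₂ - shiftDefect Φ σ d x₁ =
      (shiftDefect Φ σ (q * d + a - b) (q * x₂ - a) -
        shiftDefect Φ σ (q * d + a - b) (q * x₁ - a)) / (q * z) := by
  have hqC : (q : ℂ) ≠ 0 := by exact_mod_cast hq.ne'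
  have key : ∀ (c : ℕ) (_ : c ≤ m) (x : ℝ),
      (q * x - c ∈ Set.Icc 0 K ∧ (c < m → q * x - c ≤ 1)) →
      Φ x = φ c + (Φ (q * x - c) + c * (q * x - c : ℝ)) / (q * z) := by
    intro c hc x hx
    rw [← hΦ c hc _ hx.1 hx.2]
    congr 1
    field_simp
    ring
  have e : ∀ x : ℝ, q * x - a + (q * d + a - b) = q * (x + d) - b := fun x => by ring
  simp only [shiftDefect, e, hσ]
  rw [key a ha x₁ h₁, key a ha x₂ h₂, key b hb _ h₁', key b hb _ h₂']
  push_cast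
  field_simp
  ring

theorem greedyDigit_admissible {m : ℕ} {q K x y : ℝ} (hq : 0 < q) (hK : q * K = K + m)
    (hK1 : 1 ≤ K) (hx : 0 ≤ x) (hxy : x ≤ y) (hy : y ≤ K)
    (hbr : ∀ a : ℕ, 1 ≤ a → a ≤ m → x < a / q → y ≤ a / q) :
    q * y - greedyDigit m q x ∈ Set.Icc 0 K ∧
      (greedyDigit m q x < m → q * y - greedyDigit m q x ≤ 1) := by
  have h0 := greedyMap_nonneg m hq.le hx
  rw [greedyMap] at h0
  have h1 : 0 ≤ q * y - greedyDigit m q x := by nlinarith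
  have h2 : greedyDigit m q x < m → q * y - greedyDigit m q x ≤ 1 := by
    intro h
    have h3 := greedyMap_lt_one h
    rw [greedyMap] at h3
    have h4 := hbr (greedyDigit m q x + 1) (by omega) h (by
      rw [lt_div_iff₀ hq]
      push_cast
      linarith)
    rw [le_div_iff₀ hq] at h4
    push_cast at h4
    linarith
  refine ⟨⟨h1, ?_⟩, h2⟩
  rcases (greedyDigit_le m q x).eq_or_lt with h | h
  · rw [h]
    nlinarith
  · linarith [h2 h]

/-- If a mean of two complex numbers has the largest modulus allowed for them, they are equal. -/
theorem eq_smul_of_norm_add_eq {A B s : ℂ} {α β M : ℝ} (hα : 0 ≤ α)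
    (hA : ‖A‖ ≤ M * α) (hB : ‖B‖ ≤ M * β) (hs : ‖s‖ = M) (hAB : A + B = (α + β : ℝ) • s) :
    A = α • s := by
  have h1 := real_inner_le_norm s A
  have h2 := real_inner_le_norm s B
  have h3 : inner ℝ s (A + B) = (α + β) * M ^ 2 := by
    rw [hAB, real_inner_smul_right, real_inner_self_eq_norm_sq, hs]
  rw [inner_add_right] at h3
  have hM : 0 ≤ M := hs ▸ norm_nonneg s
  rw [hs] at h1 h2
  have h4 := mul_le_mul_of_nonneg_left hA hM
  have h5 := mul_le_mul_of_nonneg_left hB hM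
  have h6 : M ^ 2 * α ≤ inner ℝ s A := by nlinarith
  have h7 := norm_sub_sq_real A (α • s)
  rw [real_inner_smul_right, real_inner_comm, norm_smul, hs, Real.norm_of_nonneg hα] at h7
  have h8 : ‖A‖ ^ 2 ≤ (M * α) ^ 2 := by gcongr
  have h9 : ‖A - α • s‖ ^ 2 ≤ 0 := by nlinarith
  have h10 : ‖A - α • s‖ = 0 := by
    have := sq_nonneg ‖A - α • s‖
    exact pow_eq_zero_iff (two_ne_zero) |>.1 (le_antisymm h9 this)
  exact sub_eq_zero.1 (norm_eq_zero.1 h10)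

/-- A set `S` of shifts, with conjugates `σ`, which is closed under the digit steps
`d ↦ q d + s`, `|s| ≤ m`, that do not leave `[-K, K]`. -/
structure IsShiftSystem (m : ℕ) (q K : ℝ) (z : ℂ) (S : Set ℝ) (σ : ℝ → ℂ) : Prop where
  finite : S.Finite
  zero_mem : (0 : ℝ) ∈ S
  step : ∀ d ∈ S, ∀ a ≤ m, ∀ b ≤ m, |q * d + a - b| ≤ K → q * d + a - b ∈ S
  map_step : ∀ d ∈ S, ∀ a b : ℕ, σ (q * d + a - b) = z * σ d + a - b

/-- A finite grid of break points, closed under all digit steps: on an interval of the grid the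
greedy digits of `x` and of `x + d`, for a shift `d`, do not depend on `x`. -/
structure IsGrid (m : ℕ) (q K : ℝ) (S P : Set ℝ) : Prop where
  finite : P.Finite
  subset : P ⊆ Set.Icc 0 K
  step : ∀ p ∈ P, ∀ a ≤ m, q * p - a ∈ Set.Icc 0 K → q * p - a ∈ P
  left_mem : ∀ d ∈ S, |d| ≤ K → max 0 (-d) ∈ P
  break_mem : ∀ d ∈ S, ∀ a : ℕ, 1 ≤ a → a ≤ m → a / q - d ∈ Set.Icc 0 K → a / q - d ∈ P

theorem IsShiftSystem.exists_grid {m : ℕ} {q K : ℝ} {z : ℂ} {S : Set ℝ} {σ : ℝ → ℂ}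
    (hS : IsShiftSystem m q K z S σ) (hq : 0 < q) (hK : q * K = K + m) (hK1 : 1 ≤ K) :
    ∃ P, IsGrid m q K S P := by
  have hT := greedyMap_mapsTo hq.le hK hK1
  set Q : Set ℝ := (insert K ((fun a : ℕ => (a : ℝ) / q) '' Set.Iic m ∪ S)) ∩ Set.Icc 0 K with hQ
  have hQfin : Q.Finite :=
    ((((Set.finite_Iic m).image _).union hS.finite).insert K).inter_of_left _
  have hdK : greedyDigit m q K = m := by
    have := greedyDigit_div (m := m) (a := m) hq le_rfl (by linarith : 0 ≤ K)
      (fun h => absurd h (lt_irrefl _))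
    rwa [show ((m : ℝ) + K) / q = K by rw [div_eq_iff hq.ne']; linarith] at this
  have hQT : ∀ w ∈ Q, greedyMap m q w ∈ Q := by
    rintro w ⟨hw, hwI⟩
    refine ⟨?_, hT hwI⟩
    rcases hw with rfl | ⟨a, ha, rfl⟩ | hw
    · left
      rw [greedyMap, hdK]
      linarith
    · right; right
      have h1 : greedyDigit m q ((a : ℝ) / q) = a := by
        simpa using greedyDigit_div (m := m) (a := a) hq ha le_rfl (fun _ => one_pos)
      rw [greedyMap, h1, mul_div_cancel₀ _ hq.ne', sub_self]
      exact hS.zero_mem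
    · right; right
      have h1 := hS.step w hw 0 (Nat.zero_le m) (greedyDigit m q w) (greedyDigit_le m q w)
      have h2 := hT hwI
      rw [greedyMap] at h2 ⊢
      rw [Nat.cast_zero, add_zero] at h1
      exact h1 (abs_le.2 ⟨by linarith [h2.1], h2.2⟩)
  refine ⟨Set.image2 (fun w d => w - d) Q S ∩ Set.Icc 0 K, ?_, Set.inter_subset_right, ?_, ?_, ?_⟩
  · exact (hQfin.image2 _ hS.finite).inter_of_left _
  · rintro _ ⟨⟨w, hw, d, hd, rfl⟩, hI⟩ a ha hI'
    refine ⟨⟨greedyMap m q w, hQT w hw, q * d + a - greedyDigit m q w, ?_, ?_⟩, hI'⟩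
    · refine hS.step d hd a ha _ (greedyDigit_le m q w) ?_
      have h1 := hT hw.2
      have h2 : q * d + a - greedyDigit m q w = greedyMap m q w - (q * (w - d) - a) := by
        rw [greedyMap]
        ring
      rw [h2, abs_le]
      exact ⟨by linarith [h1.1, hI'.2], by linarith [h1.2, hI'.1]⟩
    · simp only [greedyMap]
      ring
  · intro d hd hdK
    have h0 : (0 : ℝ) ∈ Q := ⟨Or.inr (Or.inr hS.zero_mem), le_rfl, by linarith⟩
    have hdK' := abs_le.1 hdK
    rcases max_cases 0 (-d) with ⟨h, h'⟩ | ⟨h, h'⟩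
    · rw [h]
      exact ⟨⟨0, h0, 0, hS.zero_mem, sub_zero 0⟩, le_rfl, by linarith⟩
    · rw [h]
      exact ⟨⟨0, h0, d, hd, zero_sub d⟩, by linarith, by linarith⟩
  · intro d hd a ha0 ham hI
    refine ⟨⟨a / q, ⟨Or.inr (Or.inl ⟨a, ham, rfl⟩), by positivity, ?_⟩, d, hd, rfl⟩, hI⟩
    rw [div_le_iff₀ hq]
    have : (a : ℝ) ≤ m := by exact_mod_cast ham
    linarith

/-- The part of `[0, K]` on which the shift by `d` stays in `[0, K]`. -/
def shiftDomain (K d : ℝ) : Set ℝ := {x | x ∈ Set.Icc 0 K ∧ x + d ∈ Set.Icc 0 K}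

/-- On an interval `[p, x]` without interior grid points, a shift system passes to a new shift by
one digit step. -/
theorem IsGrid.exists_step {m : ℕ} {q K : ℝ} {z : ℂ} {S P : Set ℝ} {Φ σ : ℝ → ℂ} {φ : ℕ → ℂ}
    (hP : IsGrid m q K S P) (hS : IsShiftSystem m q K z S σ) (hq : 0 < q) (hK : q * K = K + m)
    (hK1 : 1 ≤ K) (hz : z ≠ 0)
    (hΦ : ∀ a ≤ m, ∀ y ∈ Set.Icc 0 K, (a < m → y ≤ 1) →
      Φ ((a + y) / q) = φ a + (Φ y + a * y) / (q * z))
    {d p x : ℝ} (hd : d ∈ S) (hp : p ∈ shiftDomain K d) (hx : x ∈ shiftDomain K d) (hpx : p ≤ x)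
    (hno : ∀ u ∈ P, p < u → x ≤ u) :
    ∃ d' ∈ S, ∃ a ≤ m, q * p - a ∈ shiftDomain K d' ∧ q * x - a ∈ shiftDomain K d' ∧
      shiftDefect Φ σ d x - shiftDefect Φ σ d p =
        (shiftDefect Φ σ d' (q * x - a) - shiftDefect Φ σ d' (q * p - a)) / (q * z) := by
  have hbr : ∀ e ∈ S, p ∈ shiftDomain K e → x ∈ shiftDomain K e →
      ∀ a : ℕ, 1 ≤ a → a ≤ m → p + e < a / q → x + e ≤ a / q := by
    intro e he hpe hxe a ha1 ham hlt
    by_contra hcon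
    push Not at hcon
    have hmem : (a : ℝ) / q - e ∈ Set.Icc 0 K :=
      ⟨by linarith [hpe.1.1], by linarith [hxe.1.2]⟩
    linarith [hno _ (hP.break_mem e he a ha1 ham hmem) (by linarith)]
  have h0 : ∀ y ∈ Set.Icc 0 K, y ∈ shiftDomain K 0 := fun y hy => ⟨hy, by rwa [add_zero]⟩
  have hbr0 := hbr 0 hS.zero_mem (h0 p hp.1) (h0 x hx.1)
  simp only [add_zero] at hbr0
  have hbrd := hbr d hd hp hx
  set a := greedyDigit m q p with ha
  set b := greedyDigit m q (p + d) with hb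
  have ha' : a ≤ m := greedyDigit_le m q p
  have hb' : b ≤ m := greedyDigit_le m q (p + d)
  have h1 := greedyDigit_admissible hq hK hK1 hp.1.1 le_rfl hp.1.2 (fun a _ _ h => h.le)
  have h2 := greedyDigit_admissible hq hK hK1 hp.1.1 hpx hx.1.2 hbr0
  have h3 := greedyDigit_admissible hq hK hK1 hp.2.1 le_rfl hp.2.2 (fun a _ _ h => h.le)
  have h4 := greedyDigit_admissible hq hK hK1 hp.2.1 (by linarith) hx.2.2 hbrd
  have e : ∀ y : ℝ, q * y - a + (q * d + a - b) = q * (y + d) - b := fun y => by ring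
  have hd' : q * d + a - b ∈ S := by
    refine hS.step d hd a ha' b hb' ?_
    have h5 := h1.1
    have h6 := h3.1
    have h7 := e p
    rw [abs_le]
    exact ⟨by linarith [h5.2, h6.1], by linarith [h5.1, h6.2]⟩
  exact ⟨_, hd', a, ha', ⟨h1.1, by rw [e]; exact h3.1⟩, ⟨h2.1, by rw [e]; exact h4.1⟩,
    shiftDefect_sub hq hz hΦ ha' hb' (hS.map_step d hd a b) h1 h2 h3 h4⟩

/-- On the grid the defect is constant: the slopes of the defect between grid points form a finite
set; those of the largest modulus are slopes between neighbours as well, and are therefore permuted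
by the multiplication by `z`, which is not a root of unity. -/
theorem IsGrid.shiftDefect_eq {m : ℕ} {q K : ℝ} {z : ℂ} {S P : Set ℝ} {Φ σ : ℝ → ℂ} {φ : ℕ → ℂ}
    (hP : IsGrid m q K S P) (hS : IsShiftSystem m q K z S σ) (hq : 0 < q) (hK : q * K = K + m)
    (hK1 : 1 ≤ K) (hz : 1 ≤ ‖z‖) (hroot : ∀ n : ℕ, n ≠ 0 → z ^ n ≠ 1)
    (hΦ : ∀ a ≤ m, ∀ y ∈ Set.Icc 0 K, (a < m → y ≤ 1) →
      Φ ((a + y) / q) = φ a + (Φ y + a * y) / (q * z))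
    {d p p' : ℝ} (hd : d ∈ S) (hp : p ∈ P) (hp' : p' ∈ P) (hpd : p ∈ shiftDomain K d)
    (hpd' : p' ∈ shiftDomain K d) : shiftDefect Φ σ d p = shiftDefect Φ σ d p' := by
  have hz0 : z ≠ 0 := norm_pos_iff.1 (by linarith)
  have hqC : (q : ℂ) ≠ 0 := by exact_mod_cast hq.ne'
  set sl : ℝ × ℝ × ℝ → ℂ := fun t =>
    (shiftDefect Φ σ t.1 t.2.2 - shiftDefect Φ σ t.1 t.2.1) / (t.2.2 - t.2.1 : ℝ) with hsl
  set Tr : Set (ℝ × ℝ × ℝ) := {t | t ∈ S ×ˢ (P ×ˢ P) ∧ t.2.1 < t.2.2 ∧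
    t.2.1 ∈ shiftDomain K t.1 ∧ t.2.2 ∈ shiftDomain K t.1} with hTr
  have hTrfin : Tr.Finite :=
    (hS.finite.prod (hP.finite.prod hP.finite)).subset fun t ht => ht.1
  have hzero : ∀ t ∈ Tr, sl t = 0 := by
    by_contra hcon
    push Not at hcon
    obtain ⟨t₁, ht₁, hne⟩ := hcon
    obtain ⟨t₀, ht₀, hmax⟩ := Set.exists_max_image Tr (fun t => ‖sl t‖) hTrfin ⟨t₁, ht₁⟩
    set M := ‖sl t₀‖ with hM
    have hMpos : 0 < M := lt_of_lt_of_le (norm_pos_iff.2 hne) (hmax t₁ ht₁)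
    have hstep : ∀ t ∈ Tr, ‖sl t‖ = M → ∃ t' ∈ Tr, sl t' = z * sl t := by
      rintro ⟨e, x, y⟩ ⟨⟨he, hx, hy⟩, hxy, hxd, hyd⟩ hnorm
      simp only at he hx hy hxy hxd hyd
      obtain ⟨u, ⟨⟨huP, hxu, huy⟩, humin⟩⟩ := Set.exists_min_image {u | u ∈ P ∧ x < u ∧ u ≤ y} id
        (hP.finite.subset fun u hu => hu.1) ⟨y, hy, hxy, le_rfl⟩
      have hud : u ∈ shiftDomain K e :=
        ⟨hP.subset huP, by linarith [hxd.2.1], by linarith [hyd.2.2]⟩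
      have hxuTr : (e, x, u) ∈ Tr := ⟨⟨he, hx, huP⟩, hxu, hxd, hud⟩
      have hslu : sl (e, x, u) = sl (e, x, y) := by
        rcases huy.eq_or_lt with rfl | huy
        · rfl
        · have huyTr : (e, u, y) ∈ Tr := ⟨⟨he, huP, hy⟩, huy, hud, hyd⟩
          have hform : ∀ t ∈ Tr, shiftDefect Φ σ t.1 t.2.2 - shiftDefect Φ σ t.1 t.2.1 =
              (t.2.2 - t.2.1) • sl t := by
            intro t ht
            have : ((t.2.2 - t.2.1 : ℝ) : ℂ) ≠ 0 := by
              exact_mod_cast (sub_pos.2 ht.2.1).ne'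
            rw [hsl, Complex.real_smul, mul_div_cancel₀ _ this]
          have hbd : ∀ t ∈ Tr, ‖shiftDefect Φ σ t.1 t.2.2 - shiftDefect Φ σ t.1 t.2.1‖ ≤
              M * (t.2.2 - t.2.1) := by
            intro t ht
            rw [hform t ht, norm_smul, Real.norm_of_nonneg (sub_pos.2 ht.2.1).le, mul_comm]
            exact mul_le_mul_of_nonneg_right (hmax t ht) (sub_pos.2 ht.2.1).le
          have h1 := hbd _ hxuTr
          have h2 := hbd _ huyTr
          have h3 := hform (e, x, y) ⟨⟨he, hx, hy⟩, hxy, hxd, hyd⟩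
          have h4 := hform _ hxuTr
          simp only at h1 h2 h3 h4
          have h5 := eq_smul_of_norm_add_eq (sub_pos.2 hxu).le h1 h2 hnorm (by
            rw [show u - x + (y - u) = y - x by ring, ← h3]
            ring)
          rw [h4] at h5
          exact smul_right_injective ℂ (sub_pos.2 hxu).ne' h5
      rw [← hslu]
      obtain ⟨e', he', a, ha, h1, h2, h3⟩ := hP.exists_step hS hq hK hK1 hz0 hΦ he hxd hud hxu.le
        (fun v hv hxv => by
          by_contra hvu
          push Not at hvu
          exact absurd (humin v ⟨hv, hxv, hvu.le.trans huy⟩) (not_le.2 hvu))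
      refine ⟨(e', q * x - a, q * u - a), ⟨⟨he', hP.step x hx a ha h1.1,
        hP.step u huP a ha h2.1⟩, by simp only; nlinarith, h1, h2⟩, ?_⟩
      have h4 : ((u - x : ℝ) : ℂ) ≠ 0 := by exact_mod_cast (sub_pos.2 hxu).ne'
      simp only [hsl]
      rw [h3, show q * u - a - (q * x - a) = q * (u - x) by ring, Complex.ofReal_mul]
      field_simp
    have hpow : ∀ n : ℕ, ∃ t ∈ Tr, sl t = z ^ n * sl t₀ := by
      intro n
      induction n with
      | zero => exact ⟨t₀, ht₀, by simp⟩
      | succ n ih =>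
        obtain ⟨t, ht, h⟩ := ih
        have hn : ‖sl t‖ = M := by
          refine le_antisymm (hmax t ht) ?_
          rw [h, norm_mul, norm_pow]
          exact le_mul_of_one_le_left hMpos.le (one_le_pow₀ hz)
        obtain ⟨t', ht', h'⟩ := hstep t ht hn
        exact ⟨t', ht', by rw [h', h, pow_succ]; ring⟩
    have hinj : Function.Injective fun n : ℕ => z ^ n * sl t₀ := by
      have hs0 : sl t₀ ≠ 0 := norm_pos_iff.1 hMpos
      intro i j hij
      have hij' : z ^ i = z ^ j := mul_right_cancel₀ hs0 hij
      wlog hle : i ≤ j generalizing i j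
      · exact (this hij.symm hij'.symm (by omega)).symm
      · obtain ⟨k, rfl⟩ := Nat.exists_eq_add_of_le hle
        rw [pow_add] at hij'
        have : z ^ k = 1 := (mul_eq_left₀ (pow_ne_zero i hz0)).1 hij'.symm
        by_contra hne
        exact hroot k (by omega) this
    refine Set.infinite_of_injective_forall_mem hinj (s := sl '' Tr) (fun n => ?_)
      (hTrfin.image sl)
    obtain ⟨t, ht, h⟩ := hpow n
    exact ⟨t, ht, h⟩
  have hfin : ∀ x ∈ P, ∀ y ∈ P, x ∈ shiftDomain K d → y ∈ shiftDomain K d → x < y →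
      shiftDefect Φ σ d x = shiftDefect Φ σ d y := by
    intro x hx y hy hxd hyd hxy
    have h := hzero (d, x, y) ⟨⟨hd, hx, hy⟩, hxy, hxd, hyd⟩
    simp only [hsl] at h
    have h1 : ((y - x : ℝ) : ℂ) ≠ 0 := by exact_mod_cast (sub_pos.2 hxy).ne'
    exact (sub_eq_zero.1 ((div_eq_zero_iff.1 h).resolve_right h1)).symm
  rcases lt_trichotomy p p' with h | h | h
  · exact hfin p hp p' hp' hpd hpd' h
  · rw [h]
  · exact (hfin p' hp' p hp hpd' hpd h).symm

/-- The defect is constant: digit steps contract its distance to the values on the grid. -/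
theorem IsGrid.shiftDefect_eq_of_mem {m : ℕ} {q K C : ℝ} {z : ℂ} {S P : Set ℝ} {Φ σ : ℝ → ℂ}
    {φ : ℕ → ℂ} (hP : IsGrid m q K S P) (hS : IsShiftSystem m q K z S σ) (hq : 1 < q)
    (hK : q * K = K + m) (hK1 : 1 ≤ K) (hz : 1 ≤ ‖z‖) (hroot : ∀ n : ℕ, n ≠ 0 → z ^ n ≠ 1)
    (hΦ : ∀ a ≤ m, ∀ y ∈ Set.Icc 0 K, (a < m → y ≤ 1) →
      Φ ((a + y) / q) = φ a + (Φ y + a * y) / (q * z))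
    (hC : ∀ x ∈ Set.Icc 0 K, ‖Φ x‖ ≤ C) {d x y : ℝ} (hd : d ∈ S)
    (hx : x ∈ shiftDomain K d) (hy : y ∈ shiftDomain K d) :
    shiftDefect Φ σ d x = shiftDefect Φ σ d y := by
  have hq0 : 0 < q := by linarith
  have hz0 : z ≠ 0 := norm_pos_iff.1 (by linarith)
  obtain ⟨D, hD⟩ := (hS.finite.image fun d => ‖σ d‖).bddAbove
  have hD' : ∀ e ∈ S, ‖σ e‖ ≤ D := fun e he => hD ⟨e, he, rfl⟩
  have hD0 : 0 ≤ D := (norm_nonneg _).trans (hD' 0 hS.zero_mem)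
  have hbound : ∀ e ∈ S, ∀ w ∈ shiftDomain K e, ‖shiftDefect Φ σ e w‖ ≤ C + C + D * K := by
    intro e he w hw
    refine (norm_sub_le _ _).trans (add_le_add ((norm_sub_le _ _).trans
      (add_le_add (hC _ hw.2) (hC _ hw.1))) ?_)
    rw [norm_mul, Complex.norm_real, Real.norm_of_nonneg hw.1.1]
    exact mul_le_mul (hD' e he) hw.1.2 hw.1.1 hD0
  have hsmall : ∀ n : ℕ, ∀ e ∈ S, ∀ w ∈ shiftDomain K e, ∀ p ∈ P, p ∈ shiftDomain K e →
      ‖shiftDefect Φ σ e w - shiftDefect Φ σ e p‖ ≤ 2 * (C + C + D * K) * (q⁻¹) ^ n := by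
    intro n
    induction n with
    | zero =>
      intro e he w hw p _ hpe
      have := norm_sub_le (shiftDefect Φ σ e w) (shiftDefect Φ σ e p)
      rw [pow_zero, mul_one]
      linarith [hbound e he w hw, hbound e he p hpe]
    | succ n ih =>
      intro e he w hw p hp hpe
      have heK : |e| ≤ K := abs_le.2
        ⟨by linarith [hw.1.2, hw.2.1], by linarith [hw.1.1, hw.2.2]⟩
      have hleft : max 0 (-e) ∈ shiftDomain K e :=
        ⟨hP.subset (hP.left_mem e he heK), by linarith [le_max_right 0 (-e)], by
          have := abs_le.1 heK
          rcases max_cases 0 (-e) with h | h <;> linarith⟩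
      obtain ⟨v, ⟨hvP, hve, hvw⟩, hvmax⟩ := Set.exists_max_image
        {v | v ∈ P ∧ v ∈ shiftDomain K e ∧ v ≤ w} id (hP.finite.subset fun u hu => hu.1)
        ⟨_, hP.left_mem e he heK, hleft, max_le hw.1.1 (by linarith [hw.2.1])⟩
      obtain ⟨e', he', a, ha, h1, h2, h3⟩ := hP.exists_step hS hq0 hK hK1 hz0 hΦ he hve hw hvw
        (fun u hu hvu => by
          by_contra huw
          push Not at huw
          exact absurd (hvmax u ⟨hu, ⟨hP.subset hu, by linarith [hve.2.1],
            by linarith [hw.2.2]⟩, huw.le⟩) (not_le.2 hvu))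
      rw [hP.shiftDefect_eq hS hq0 hK hK1 hz hroot hΦ he hp hvP hpe hve, h3, norm_div, norm_mul,
        Complex.norm_real, Real.norm_of_nonneg hq0.le]
      have h4 := ih e' he' _ h2 _ (hP.step v hvP a ha h1.1) h1
      calc _ ≤ ‖shiftDefect Φ σ e' (q * w - a) - shiftDefect Φ σ e' (q * v - a)‖ / q := by
            gcongr
            exact le_mul_of_one_le_right hq0.le hz
        _ ≤ 2 * (C + C + D * K) * q⁻¹ ^ n / q := by gcongr
        _ = _ := by rw [pow_succ]; field_simp
  have hgrid : ∀ w ∈ shiftDomain K d, ∀ p ∈ P, p ∈ shiftDomain K d →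
      shiftDefect Φ σ d w = shiftDefect Φ σ d p := by
    intro w hw p hp hpd
    have h1 : Filter.Tendsto (fun n : ℕ => 2 * (C + C + D * K) * (q⁻¹) ^ n) Filter.atTop
        (nhds (2 * (C + C + D * K) * 0)) :=
      (tendsto_pow_atTop_nhds_zero_of_lt_one (by positivity)
        (inv_lt_one_of_one_lt₀ hq)).const_mul _
    rw [mul_zero] at h1
    have h2 := ge_of_tendsto' h1 (fun n => hsmall n d hd w hw p hp hpd)
    exact sub_eq_zero.1 (norm_le_zero_iff.1 h2)
  have hdK : |d| ≤ K := abs_le.2 ⟨by linarith [hx.1.2, hx.2.1], by linarith [hx.1.1, hx.2.2]⟩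
  have hleft : max 0 (-d) ∈ shiftDomain K d :=
    ⟨hP.subset (hP.left_mem d hd hdK), by linarith [le_max_right 0 (-d)], by
      have := abs_le.1 hdK
      rcases max_cases 0 (-d) with h | h <;> linarith⟩
  rw [hgrid x hx _ (hP.left_mem d hd hdK) hleft, hgrid y hy _ (hP.left_mem d hd hdK) hleft]

/-- The averages of the self-similar distribution over intervals of a fixed length give a bounded
function on `[0, 1]` which changes by exactly `σ d` under every shift by an element `d` of the
spectrum. -/
theorem exists_bounded_of_finite {m : ℕ} {q : ℝ} {z : ℂ} (hm : 1 ≤ m) (hq : 1 < q)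
    (hqm : q < m + 1) (hconj : SameRoots q z) (hz : 1 ≤ ‖z‖)
    (hfin : ∀ R : ℝ, (mSpectrum m q ∩ Set.Icc (-R) R).Finite) :
    ∃ (F : ℝ → ℂ) (C : ℝ), (∀ r ∈ Set.Icc (0 : ℝ) 1, ‖F r‖ ≤ C) ∧
      ∀ d ∈ mSpectrum m q, ∀ r ∈ Set.Icc (0 : ℝ) 1, r + d ∈ Set.Icc (0 : ℝ) 1 →
        F (r + d) = F r + conjMap q z d := by
  have hq0 : 0 < q := by linarith
  set K : ℝ := m / (q - 1) with hKdef
  have hq1 : 0 < q - 1 := by linarith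
  have hK : q * K = K + m := by
    rw [hKdef]
    field_simp
    ring
  have hK1 : 1 < K := by
    rw [hKdef, one_lt_div hq1]
    linarith
  set S := mSpectrum m q ∩ Set.Icc (-K) K with hSdef
  have hS : IsShiftSystem m q K z S (conjMap q z) := by
    refine ⟨hfin K, ⟨zero_mem_mSpectrum m q, by linarith, by linarith⟩,
      fun d hd a ha b hb habs => ⟨?_, abs_le.1 habs⟩, fun d hd a b => ?_⟩
    · have := mSpectrum_mul_add hd.1 (s := (a : ℤ) - b) (by rw [abs_le]; omega)
      push_cast at this
      rwa [add_sub_assoc]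
    · have := conjMap_mul_add hconj (mSpectrum_subset_intRange d hd.1) ((a : ℤ) - b)
      push_cast at this
      rw [add_sub_assoc, this, add_sub_assoc]
  obtain ⟨P, hP⟩ := hS.exists_grid hq0 hK hK1.le
  have hz1 : z ≠ 1 := fun h => pow_ne_one_of_sameRoots hconj hq one_ne_zero (by rw [h, one_pow])
  obtain ⟨Φ, φ, C, hC, hΦ⟩ := exists_selfSimilar_primitive hm hq hK hK1.le hz hz1
  have hδ : ((K - 1 : ℝ) : ℂ) ≠ 0 := by exact_mod_cast (sub_pos.2 hK1).ne'
  refine ⟨fun r => (Φ (r + (K - 1)) - Φ r) / (K - 1 : ℝ), (C + C) / (K - 1),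
    fun r hr => ?_, fun d hd r hr hrd => ?_⟩
  · rw [norm_div, Complex.norm_real, Real.norm_of_nonneg (sub_pos.2 hK1).le]
    have : 0 < K - 1 := sub_pos.2 hK1
    gcongr
    exact (norm_sub_le _ _).trans (add_le_add (hC _ ⟨by linarith [hr.1], by linarith [hr.2]⟩)
      (hC _ ⟨hr.1, by linarith [hr.2]⟩))
  · have hdS : d ∈ S := ⟨hd, by linarith [hr.2, hrd.1], by linarith [hr.1, hrd.2]⟩
    have h := hP.shiftDefect_eq_of_mem hS hq hK hK1.le hz
      (fun n hn => pow_ne_one_of_sameRoots hconj hq hn) hΦ hC hdS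
      (x := r + (K - 1)) (y := r)
      ⟨⟨by linarith [hr.1], by linarith [hr.2]⟩, by linarith [hrd.1], by linarith [hrd.2]⟩
      ⟨⟨hr.1, by linarith [hr.2]⟩, hrd.1, by linarith [hrd.2]⟩
    simp only [shiftDefect] at h
    rw [show r + (K - 1) + d = r + d + (K - 1) by ring] at h
    field_simp
    push_cast at h ⊢
    linear_combination h

/-! ### Pairs of spectrum elements at distance one -/

/-- A finite sum of decreasing nonnegative coefficients against the powers of a number `w ≠ 1` of
modulus at most `1` does not vanish (Eneström–Kakeya). -/
theorem sum_mul_pow_ne_zero {b : ℕ → ℝ} {n : ℕ} {w : ℂ} (hb : Antitone b) (h01 : b 1 < b 0)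
    (hn : ∀ j, n ≤ j → b j = 0) (hw : ‖w‖ ≤ 1) (hw1 : w ≠ 1) :
    ∑ j ∈ Finset.range n, (b j : ℂ) * w ^ j ≠ 0 := by
  intro h0
  refine hw1 (eq_one_of_hasSum_twist (a := fun j => b j - b (j + 1)) (s := b 0)
    (fun j => sub_nonneg.2 (hb (Nat.le_succ j))) (sub_pos.2 h01) hw ?_ ?_)
  · have h1 : HasSum (fun j => b j - b (j + 1)) (∑ j ∈ Finset.range n, (b j - b (j + 1))) :=
      hasSum_sum_of_ne_finset_zero fun j hj => by
        rw [Finset.mem_range, not_lt] at hj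
        rw [hn j hj, hn (j + 1) (by omega), sub_zero]
    rwa [Finset.sum_range_sub', hn n le_rfl, sub_zero] at h1
  · have h1 : HasSum (fun j => ((b j - b (j + 1) : ℝ) : ℂ) * w ^ (j + 1))
        (∑ j ∈ Finset.range n, ((b j - b (j + 1) : ℝ) : ℂ) * w ^ (j + 1)) :=
      hasSum_sum_of_ne_finset_zero fun j hj => by
        rw [Finset.mem_range, not_lt] at hj
        rw [hn j hj, hn (j + 1) (by omega), sub_zero, Complex.ofReal_zero, zero_mul]
    have h2 : ∑ j ∈ Finset.range n, (b (j + 1) : ℂ) * w ^ (j + 1) = -b 0 := by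
      have h3 := Finset.sum_range_succ' (fun j => (b j : ℂ) * w ^ j) n
      rw [Finset.sum_range_succ, h0, hn n le_rfl] at h3
      simp only [Complex.ofReal_zero, zero_mul, add_zero, pow_zero, mul_one] at h3
      linear_combination -h3
    have h4 : ∑ j ∈ Finset.range n, ((b j - b (j + 1) : ℝ) : ℂ) * w ^ (j + 1) = b 0 := by
      calc _ = w * ∑ j ∈ Finset.range n, (b j : ℂ) * w ^ j
            - ∑ j ∈ Finset.range n, (b (j + 1) : ℂ) * w ^ (j + 1) := by
            rw [Finset.mul_sum, ← Finset.sum_sub_distrib]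
            refine Finset.sum_congr rfl fun j _ => ?_
            push_cast
            ring
        _ = b 0 := by rw [h0, h2]; ring
    rwa [h4] at h1

/-- Some `v` strictly between `0` and `1` is such that `v` and `v - 1` lie in the spectrum.
Otherwise the orbit of `1` under `x ↦ q x - m` becomes an integer when it leaves `(0, ∞)`, and
comparing it with its conjugate orbit contradicts `sum_mul_pow_ne_zero`. -/
theorem exists_unit_gap {m : ℕ} {q : ℝ} {z : ℂ} (hm : 1 ≤ m) (hmq : m < q) (hqm : q < m + 1)
    (hconj : SameRoots q z) (hz : 1 ≤ ‖z‖) (hzq : z ≠ q) :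
    ∃ v ∈ mSpectrum m q, 0 < v ∧ v < 1 ∧ v - 1 ∈ mSpectrum m q := by
  by_contra hV
  push Not at hV
  have hm' : (1 : ℝ) ≤ m := by exact_mod_cast hm
  have hq : 1 < q := by linarith
  have hq0 : 0 < q := by linarith
  have hz0 : z ≠ 0 := norm_pos_iff.1 (by linarith)
  have hq1 : 0 < q - 1 := by linarith
  obtain ⟨K, hK⟩ : ∃ K : ℝ, K = m / (q - 1) := ⟨_, rfl⟩
  have hK1 : 1 < K := by
    rw [hK, one_lt_div hq1]
    linarith
  have hKq : q * K = K + m := by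
    rw [hK]
    field_simp
    ring
  set o : ℕ → ℝ := fun j => K - (K - 1) * q ^ j with ho
  have ho0 : o 0 = 1 := by simp [ho]
  have hos : ∀ j, o (j + 1) = q * o j - m := fun j => by
    simp only [ho, pow_succ]
    linear_combination -hKq
  have hanti : StrictAnti o := strictAnti_nat_of_succ_lt fun j => by
    have h1 : 0 < q ^ j := by positivity
    have h2 : q ^ j < q ^ (j + 1) := pow_lt_pow_right₀ hq (Nat.lt_succ_self j)
    simp only [ho]
    nlinarith
  have hoY : ∀ j, o j ∈ mSpectrum m q := by
    intro j
    induction j with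
    | zero => rw [ho0]; exact one_mem_mSpectrum hm q
    | succ j ih =>
      rw [hos]
      simpa [sub_eq_add_neg] using mSpectrum_mul_add ih (s := -(m : ℤ)) (by simp)
  have hex : ∃ n, o n ≤ 0 := by
    obtain ⟨n, hn⟩ := pow_unbounded_of_one_lt (K / (K - 1)) hq
    rw [div_lt_iff₀ (by linarith)] at hn
    exact ⟨n, by simp only [ho]; linarith⟩
  classical
  obtain ⟨i, hi⟩ : ∃ i, Nat.find hex = i + 1 := Nat.exists_eq_succ_of_ne_zero fun h => by
    have := Nat.find_spec hex
    rw [h, ho0] at this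
    linarith
  have hneg : o (i + 1) ≤ 0 := hi ▸ Nat.find_spec hex
  have hpos : ∀ j, j ≤ i → 0 < o j := fun j hj => not_le.1 (Nat.find_min hex (by omega))
  have hqo : 0 < q * o i := mul_pos hq0 (hpos i le_rfl)
  have hfl := Nat.floor_le hqo.le
  have hlf := Nat.lt_floor_add_one (q * o i)
  set c := ⌊q * o i⌋₊ with hc
  have hcm : c ≤ m := by
    have : (c : ℝ) ≤ m := by linarith [hos i]
    exact_mod_cast this
  have hint : q * o i = c := by
    by_contra hne
    have hlt : (c : ℝ) < q * o i := lt_of_le_of_ne hfl (Ne.symm hne)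
    have hcm' : c < m := by
      have : (c : ℝ) < m := by linarith [hos i]
      exact_mod_cast this
    have h1 := mSpectrum_mul_add (hoY i) (s := -(c : ℤ)) (by simpa using hcm)
    have h2 := mSpectrum_mul_add (hoY i) (s := -((c : ℤ) + 1)) (by rw [abs_le]; omega)
    push_cast at h1 h2
    exact hV _ h1 (by linarith) (by linarith)
      (by rwa [show q * o i + -(c : ℝ) - 1 = q * o i + -((c : ℝ) + 1) by ring])
  set s : ℕ → ℂ := fun j => conjMap q z (o j) with hs
  have hs0 : s 0 = 1 := by
    simp only [hs, ho0]
    exact conjMap_one hconj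
  have hss : ∀ j, s (j + 1) = z * s j - m := fun j => by
    have := conjMap_mul_add hconj (mSpectrum_subset_intRange _ (hoY j)) (-(m : ℤ))
    simp only [hs, hos]
    push_cast at this
    rw [sub_eq_add_neg, this, sub_eq_add_neg]
  have hsi : s (i + 1) = o (i + 1) := by
    have h1 : o (i + 1) = (((c : ℤ) - m : ℤ) : ℝ) := by
      rw [hos, hint]
      push_cast
      ring
    simp only [hs]
    rw [h1, conjMap_intCast hconj]
    norm_cast
  have hsum : ∀ n, z * (s n - o n) = (z - q) * z ^ n *
      ∑ j ∈ Finset.range n, (o j : ℂ) * z⁻¹ ^ j := by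
    intro n
    induction n with
    | zero => simp [hs0, ho0]
    | succ n ih =>
      have h1 : z ^ n * z⁻¹ ^ n = 1 := by rw [← mul_pow, mul_inv_cancel₀ hz0, one_pow]
      rw [Finset.sum_range_succ, hss, hos]
      push_cast
      linear_combination z * ih - (z - q) * z * o n * h1
  have h1 := hsum (i + 1)
  rw [hsi, sub_self, mul_zero, eq_comm, mul_eq_zero] at h1
  have h2 := h1.resolve_left (mul_ne_zero (sub_ne_zero.2 hzq) (pow_ne_zero _ hz0))
  refine sum_mul_pow_ne_zero (b := fun j => max (o j) 0) (n := i + 1) (w := z⁻¹)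
    (fun j k hjk => max_le_max_right 0 (hanti.antitone hjk)) ?_ (fun j hj => ?_) ?_ ?_ ?_
  · have : o 1 < o 0 := hanti Nat.zero_lt_one
    simp only [ho0] at this ⊢
    simp [this]
  · exact max_eq_right ((hanti.antitone hj).trans hneg)
  · rw [norm_inv]
    exact inv_le_one_of_one_le₀ hz
  · rw [ne_eq, inv_eq_one]
    exact fun h => pow_ne_one_of_sameRoots hconj hq one_ne_zero (by rw [h, one_pow])
  · rw [← h2]
    refine Finset.sum_congr rfl fun j hj => ?_
    rw [max_eq_left (hpos j (by rw [Finset.mem_range] at hj; omega)).le]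

/-! ### A short exact shift -/

/-- The function `F` on `[0, 1]` changes by `c` under the shift by `d`. -/
def ShiftsBy (F : ℝ → ℂ) (d : ℝ) (c : ℂ) : Prop :=
  ∀ r ∈ Set.Icc (0 : ℝ) 1, r + d ∈ Set.Icc (0 : ℝ) 1 → F (r + d) = F r + c

/-- A shift by `ε` is exact if it is a composition, in a suitable order, of two exact shifts, by
`-y` and by `y + ε`, for a small `y`. -/
theorem shiftsBy_of_add {F : ℝ → ℂ} {ε y : ℝ} {α β : ℂ} (h1 : ShiftsBy F (-y) (-α))
    (h2 : ShiftsBy F (y + ε) (α + β)) (hε : 0 < ε) (hy : -ε ≤ y) (hy' : y ≤ (1 - ε) / 2) :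
    ShiftsBy F ε β := by
  rintro r ⟨hr0, hr1⟩ ⟨hr2, hr3⟩
  by_cases hA : r + (y + ε) ≤ 1
  · have h3 := h2 r ⟨hr0, hr1⟩ ⟨by linarith, hA⟩
    have h4 := h1 (r + (y + ε)) ⟨by linarith, hA⟩ ⟨by linarith, by linarith⟩
    rw [show r + (y + ε) + -y = r + ε by ring] at h4
    rw [h4, h3]
    ring
  · push Not at hA
    have h3 := h1 r ⟨hr0, hr1⟩ ⟨by linarith, by linarith⟩
    have h4 := h2 (r + -y) ⟨by linarith, by linarith⟩ ⟨by linarith, by linarith⟩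
    rw [show r + -y + (y + ε) = r + ε by ring] at h4
    rw [h4, h3]
    ring

/-- The shift by `m + 1 - q` is exact although this number need not lie in the spectrum. -/
theorem shiftsBy_add_one_sub {m : ℕ} {q : ℝ} {z : ℂ} {F : ℝ → ℂ} (hm : 1 ≤ m) (hmq : m < q)
    (hqm : q < m + 1) (hconj : SameRoots q z) (hz : 1 ≤ ‖z‖) (hzq : z ≠ q)
    (hfin : ∀ R : ℝ, (mSpectrum m q ∩ Set.Icc (-R) R).Finite)
    (hF : ∀ d ∈ mSpectrum m q, ShiftsBy F d (conjMap q z d)) :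
    ShiftsBy F (m + 1 - q) (conjMap q z (m + 1 - q)) := by
  have hm' : (1 : ℝ) ≤ m := by exact_mod_cast hm
  have hq0 : 0 < q := by linarith
  obtain ⟨p, ⟨hpY, hp0, hp1, hpY'⟩, hpmax⟩ := Set.exists_max_image
    {v | v ∈ mSpectrum m q ∧ 0 < v ∧ v ≤ 1 / 2 ∧ v - 1 ∈ mSpectrum m q} id
    ((hfin 1).subset fun v hv => ⟨hv.1, by linarith [hv.2.1], by linarith [hv.2.2.1]⟩) (by
      obtain ⟨v, hvY, hv0, hv1, hvY'⟩ := exists_unit_gap hm hmq hqm hconj hz hzq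
      rcases le_total v (1 / 2) with h | h
      · exact ⟨v, hvY, hv0, h, hvY'⟩
      · refine ⟨1 - v, ?_, by linarith, by linarith, ?_⟩
        · simpa using neg_mem_mSpectrum hvY'
        · simpa using neg_mem_mSpectrum hvY)
  have hqp : 1 / 2 ≤ q * p := by
    by_contra hlt
    push Not at hlt
    have h1 := mSpectrum_mul_add hpY (s := 0) (by simp)
    have h2 := mSpectrum_mul_add hpY (s := -1) (by simpa using hm)
    push_cast at h1 h2
    rw [add_zero] at h1
    have h3 := hpmax (q * p) ⟨h1, by positivity, hlt.le, h2⟩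
    simp only [id] at h3
    nlinarith
  obtain ⟨ε, hε⟩ : ∃ ε : ℝ, ε = m + 1 - q := ⟨_, rfl⟩
  rw [← hε]
  have hε0 : 0 < ε := by linarith
  have hu : 0 < q * p - (1 - ε) / 2 := by linarith
  have hc0 : 0 < ⌈q * p - (1 - ε) / 2⌉₊ := Nat.ceil_pos.2 hu
  have hc1 := Nat.le_ceil (q * p - (1 - ε) / 2)
  have hc2 := Nat.ceil_lt_add_one hu.le
  have hcm : ⌈q * p - (1 - ε) / 2⌉₊ ≤ m := Nat.ceil_le.2 (by nlinarith)
  generalize ⌈q * p - (1 - ε) / 2⌉₊ = c at hc0 hc1 hc2 hcm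
  obtain ⟨y, hy⟩ : ∃ y : ℝ, y = q * p - c := ⟨_, rfl⟩
  have hyY : y ∈ mSpectrum m q := by
    have := mSpectrum_mul_add hpY (s := -(c : ℤ)) (by simpa using hcm)
    push_cast at this
    rwa [hy, sub_eq_add_neg]
  have hyεY : y + ε ∈ mSpectrum m q := by
    have := mSpectrum_mul_add hpY' (s := (m : ℤ) + 1 - c) (by rw [abs_le]; omega)
    push_cast at this
    rwa [hy, hε, show q * p - c + (m + 1 - q) = q * (p - 1) + (m + 1 - c) by ring]
  have hεZ : ε ∈ intRange q := by
    rw [hε]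
    exact sub_mem (add_mem (natCast_mem _ m) (one_mem _)) (self_mem_intRange q)
  have hyZ := mSpectrum_subset_intRange y hyY
  have hyεZ := mSpectrum_subset_intRange _ hyεY
  rcases le_total (-ε) y with h | h
  · refine shiftsBy_of_add (y := y) (α := conjMap q z y) ?_ ?_ hε0 h (by linarith)
    · rw [← conjMap_neg hconj hyZ]
      exact hF _ (neg_mem_mSpectrum hyY)
    · rw [← conjMap_add hconj hyZ hεZ]
      exact hF _ hyεY
  · refine shiftsBy_of_add (y := -(y + ε)) (α := -conjMap q z (y + ε)) ?_ ?_ hε0 (by linarith)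
      (by linarith)
    · rw [neg_neg, neg_neg]
      exact hF _ hyεY
    · rw [show -(y + ε) + ε = -y by ring, ← conjMap_neg hconj hyεZ,
        ← conjMap_add hconj (neg_mem hyεZ) hεZ, show -(y + ε) + ε = -y by ring]
      exact hF _ (neg_mem_mSpectrum hyY)

/-- Consecutive elements of the nonnegative spectrum at distance more than `1 - b` are at distance
`1`, if `b` is at most `m + 1 - q` and at most every `v ∈ (0, 1)` for which `v` and `v - 1` lie in
the spectrum. -/
theorem eq_add_one_of_consecutive {m : ℕ} {q b x x' : ℝ} (hq : 1 < q) (hqm : q < m + 1)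
    (hbε : b ≤ m + 1 - q)
    (hbV : ∀ v ∈ mSpectrum m q, 0 < v → v < 1 → v - 1 ∈ mSpectrum m q → b ≤ v)
    (hx : x ∈ posSpectrum m q) (hx' : x' ∈ posSpectrum m q) (hxx' : x < x')
    (hnext : ∀ u ∈ posSpectrum m q, x < u → x' ≤ u) (hgap : 1 - b < x' - x) : x' = x + 1 := by
  have hq0 : 0 < q := by linarith
  by_contra hne
  have hle : x' ≤ x + 1 := by
    obtain ⟨w, hw, h1, h2⟩ := exists_posSpectrum_pred hq hqm hx'
      (lt_of_le_of_lt (posSpectrum_nonneg hq0.le hx) hxx')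
    by_contra h3
    push Not at h3
    linarith [hnext w hw (by linarith)]
  have hlt : x' < x + 1 := lt_of_le_of_ne hle hne
  -- `1 - (x' - x) < b` would violate the choice of `b`
  have hkey : x + 1 - x' ∈ mSpectrum m q → False := fun h => by
    have h1 := hbV _ h (by linarith) (by linarith) (by
      rw [show x + 1 - x' - 1 = x - x' by ring]
      exact sub_mem_mSpectrum hx hx')
    linarith
  have hx1 : x + 1 ∉ posSpectrum m q := fun h => hkey (sub_mem_mSpectrum h hx')
  have hx'1 : x' - 1 ∉ posSpectrum m q := fun h => hkey (by
    rw [show x + 1 - x' = x - (x' - 1) by ring]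
    exact sub_mem_mSpectrum hx h)
  obtain ⟨y, hy, a, ha, hxy⟩ := exists_eq_mul_add_of_mem_posSpectrum hx
  obtain ⟨y', hy', a', ha', hxy'⟩ := exists_eq_mul_add_of_mem_posSpectrum hx'
  have ham : a = m := by
    by_contra h
    refine hx1 ?_
    have := posSpectrum_mul_add hy (a := a + 1) (by omega)
    push_cast at this
    rwa [hxy, add_assoc]
  have ha'0 : a' = 0 := by
    by_contra h
    obtain ⟨k, rfl⟩ := Nat.exists_eq_succ_of_ne_zero h
    refine hx'1 ?_
    have := posSpectrum_mul_add hy' (a := k) (by omega)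
    push_cast at hxy'
    rwa [hxy', show q * y' + (k + 1) - 1 = q * y' + k by ring]
  subst ham ha'0
  rw [Nat.cast_zero, add_zero] at hxy'
  have hyy' : y + 1 < y' := by
    by_contra h
    push Not at h
    have : q * y' ≤ q * (y + 1) := mul_le_mul_of_nonneg_left h hq0.le
    linarith
  obtain ⟨w, hw, hw1, hw2⟩ := exists_posSpectrum_pred hq hqm hy'
    (by linarith [posSpectrum_nonneg hq0.le hy])
  have hwx : q * w ≤ x := by
    by_contra h
    push Not at h
    have h1 := hnext (q * w) (by simpa using posSpectrum_mul_add hw (Nat.zero_le a)) h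
    have h2 : q * w < q * y' := mul_lt_mul_of_pos_left hw2 hq0
    linarith
  have hxw : x < q * w + a := by
    have : q * y < q * w := mul_lt_mul_of_pos_left (by linarith) hq0
    linarith
  have h0 : 0 ≤ x - q * w := by linarith
  have hfl := Nat.floor_le h0
  have hlf := Nat.lt_floor_add_one (x - q * w)
  have hka : ⌊x - q * w⌋₊ < a := (Nat.floor_lt h0).2 (by linarith)
  generalize ⌊x - q * w⌋₊ = k at hfl hlf hka
  have hu := posSpectrum_mul_add hw (a := k + 1) hka
  have hk := posSpectrum_mul_add hw (a := k) hka.le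
  push_cast at hu
  have hux : x' ≤ q * w + (k + 1) := hnext _ hu (by linarith)
  rcases (sub_nonneg.2 hfl).eq_or_lt with he | he
  · refine hx1 ?_
    rwa [show x + 1 = q * w + (k + 1) by linarith]
  · have h1 := hbV (x - (q * w + k)) (sub_mem_mSpectrum hx hk) (by linarith) (by linarith) (by
      rw [show x - (q * w + k) - 1 = x - (q * w + (k + 1)) by ring]
      exact sub_mem_mSpectrum hx hu)
    linarith

/-! ### Extension to the half-line -/

/-- If the shifts by `b` and `b - 1` are exact and gaps of the nonnegative spectrum exceeding
`1 - b` have length `1`, then `F` extends to the half-line as a function which is additive along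
the multiples of `b`. -/
theorem exists_extension {m : ℕ} {q b : ℝ} {z : ℂ} {F : ℝ → ℂ} (hm : 1 ≤ m) (hq : 1 < q)
    (hqm : q < m + 1) (hconj : SameRoots q z)
    (hfin : ∀ R : ℝ, (mSpectrum m q ∩ Set.Icc (-R) R).Finite)
    (hF : ∀ d ∈ mSpectrum m q, ShiftsBy F d (conjMap q z d))
    (hb0 : 0 < b) (hb1 : b < 1) (hbZ : b ∈ intRange q)
    (hFb : ShiftsBy F b (conjMap q z b)) (hFb' : ShiftsBy F (b - 1) (conjMap q z (b - 1)))
    (hgap : ∀ x ∈ posSpectrum m q, ∀ x' ∈ posSpectrum m q, x < x' →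
      (∀ u ∈ posSpectrum m q, x < u → x' ≤ u) → 1 - b < x' - x → x' = x + 1) :
    ∃ f : ℝ → ℂ, (∀ t, ∀ x ∈ posSpectrum m q, t - x ∈ Set.Icc (0 : ℝ) 1 →
        f t = conjMap q z x + F (t - x)) ∧
      ∀ t, 0 ≤ t → f (t + b) = f t + conjMap q z b := by
  have hq0 : 0 < q := by linarith
  have hXZ : ∀ x ∈ posSpectrum m q, x ∈ intRange q :=
    fun x hx => mSpectrum_subset_intRange x (posSpectrum_subset hx)
  have hXfin : ∀ R : ℝ, (posSpectrum m q ∩ Set.Icc 0 R).Finite := fun R =>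
    (hfin R).subset fun x hx => ⟨posSpectrum_subset hx.1,
      by linarith [hx.2.1, hx.2.2], hx.2.2⟩
  choose! g hgX hg1 hg2 using fun t (ht : (0 : ℝ) ≤ t) => exists_posSpectrum_le_lt hq hqm ht
  have hval : ∀ t, ∀ x ∈ posSpectrum m q, t - x ∈ Set.Icc (0 : ℝ) 1 →
      conjMap q z (g t) + F (t - g t) = conjMap q z x + F (t - x) := by
    intro t x hx htx
    have ht : 0 ≤ t := by linarith [posSpectrum_nonneg hq0.le hx, htx.1]
    have h1 := hF _ (sub_mem_mSpectrum (hgX t ht) hx) (t - g t)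
      ⟨by linarith [hg1 t ht], by linarith [hg2 t ht]⟩
    rw [show t - g t + (g t - x) = t - x by ring, conjMap_sub hconj (hXZ _ (hgX t ht)) (hXZ x hx)]
      at h1
    rw [h1 htx]
    ring
  refine ⟨fun t => conjMap q z (g t) + F (t - g t), hval, fun t ht => ?_⟩
  simp only
  obtain ⟨x, ⟨hx, hx0, hxt⟩, hxmax⟩ := Set.exists_max_image _ id (hXfin t)
    ⟨0, zero_mem_posSpectrum m q, le_rfl, ht⟩
  simp only [id] at hxmax
  have htx : t < x + 1 := by
    have := hxmax (g t) ⟨hgX t ht, posSpectrum_nonneg hq0.le (hgX t ht), hg1 t ht⟩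
    linarith [hg2 t ht]
  rw [hval t x hx ⟨by linarith, by linarith⟩]
  rcases le_or_gt (t - x) (1 - b) with hr | hr
  · rw [hval (t + b) x hx ⟨by linarith, by linarith⟩, show t + b - x = t - x + b by ring,
      hFb _ ⟨by linarith, by linarith⟩ ⟨by linarith, by linarith⟩]
    ring
  · obtain ⟨n, hn⟩ := pow_unbounded_of_one_lt t hq
    obtain ⟨x', ⟨⟨hx', -, hx'n⟩, htx'⟩, hx'min⟩ := Set.exists_min_image
      {u | u ∈ posSpectrum m q ∩ Set.Icc 0 (q ^ n) ∧ t < u} id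
      ((hXfin (q ^ n)).subset fun u hu => hu.1)
      ⟨q ^ n, ⟨pow_mem_posSpectrum hm q n, by positivity, le_rfl⟩, hn⟩
    simp only [id] at hx'min
    have hx'1 : x' = x + 1 := by
      refine hgap x hx x' hx' (by linarith) (fun u hu hxu => ?_) (by linarith)
      have hu0 := posSpectrum_nonneg hq0.le hu
      rcases le_or_gt u t with h | h
      · linarith [hxmax u ⟨hu, hu0, h⟩]
      · rcases le_or_gt u (q ^ n) with h' | h'
        · exact hx'min u ⟨⟨hu, hu0, h'⟩, h⟩
        · linarith
    rw [hval (t + b) x' hx' ⟨by linarith, by linarith⟩, hx'1,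
      show t + b - (x + 1) = t - x + (b - 1) by ring,
      hFb' _ ⟨by linarith, by linarith⟩ ⟨by linarith, by linarith⟩,
      conjMap_add hconj (hXZ x hx) (one_mem _), conjMap_sub hconj hbZ (one_mem _)]
    ring

/-- If the spectrum of `q ∈ (m, m + 1)` is locally finite, then the only conjugate of `q` outside
the open unit disc is `q`: the bounded function provided by `exists_bounded_of_finite` forces the
powers of the conjugate to stay within bounded distance of a multiple of the powers of `q`. -/
theorem eq_of_finite_of_sameRoots {m : ℕ} {q : ℝ} {z : ℂ} (hm : 1 ≤ m) (hmq : m < q)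
    (hqm : q < m + 1) (hconj : SameRoots q z) (hz : 1 ≤ ‖z‖)
    (hfin : ∀ R : ℝ, (mSpectrum m q ∩ Set.Icc (-R) R).Finite) : z = q := by
  by_contra hzq
  have hm' : (1 : ℝ) ≤ m := by exact_mod_cast hm
  have hq : 1 < q := by linarith
  have hq0 : 0 < q := by linarith
  obtain ⟨F, C, hC, hF⟩ := exists_bounded_of_finite hm hq hqm hconj hz hfin
  have hεF := shiftsBy_add_one_sub hm hmq hqm hconj hz hzq hfin hF
  obtain ⟨b, hb, hbmin⟩ := Set.exists_min_image
    (insert ((m : ℝ) + 1 - q)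
      {v | v ∈ mSpectrum m q ∧ 0 < v ∧ v < 1 ∧ v - 1 ∈ mSpectrum m q}) id
    (((hfin 1).subset fun v hv => ⟨hv.1, by linarith [hv.2.1], by linarith [hv.2.2.1]⟩).insert _)
    (Set.insert_nonempty _ _)
  simp only [id] at hbmin
  obtain ⟨hb0, hb1, hbZ, hbF, hbY⟩ : 0 < b ∧ b < 1 ∧ b ∈ intRange q ∧
      ShiftsBy F b (conjMap q z b) ∧ b - 1 ∈ mSpectrum m q := by
    rcases hb with rfl | ⟨h1, h2, h3, h4⟩
    · refine ⟨by linarith, by linarith, ?_, hεF, ?_⟩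
      · exact sub_mem (add_mem (natCast_mem _ m) (one_mem _)) (self_mem_intRange q)
      · have := mSpectrum_mul_add (neg_mem_mSpectrum (one_mem_mSpectrum hm q)) (s := (m : ℤ))
          (by simp)
        push_cast at this
        rwa [show (m : ℝ) + 1 - q - 1 = q * -1 + m by ring]
    · exact ⟨h2, h3, mSpectrum_subset_intRange b h1, hF b h1, h4⟩
  obtain ⟨f, hf, hfb⟩ := exists_extension hm hq hqm hconj hfin hF hb0 hb1 hbZ hbF (hF _ hbY)
    (fun x hx x' hx' hxx' hnext hgap => eq_add_one_of_consecutive hq hqm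
      (hbmin _ (Set.mem_insert _ _))
      (fun v hv h0 h1 h2 => hbmin v (Set.mem_insert_of_mem _ ⟨hv, h0, h1, h2⟩))
      hx hx' hxx' hnext hgap)
  set β := conjMap q z b with hβ
  have hmul : ∀ n : ℕ, f (n * b) = f 0 + n * β := by
    intro n
    induction n with
    | zero => simp
    | succ n ih =>
      have := hfb (n * b) (by positivity)
      push_cast
      rw [show ((n : ℝ) + 1) * b = n * b + b by ring, this, ih]
      ring
  obtain ⟨D, hD⟩ := ((hfin 2).image fun d => ‖conjMap q z d‖).bddAbove
  obtain ⟨l, hl⟩ : ∃ l : ℂ, l = β / b := ⟨_, rfl⟩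
  have hbC : (b : ℂ) ≠ 0 := by exact_mod_cast hb0.ne'
  have hl0 : l ≠ 0 := by
    rw [hl]
    exact div_ne_zero (conjMap_ne_zero hconj hbZ hb0.ne') hbC
  obtain ⟨M, hM⟩ : ∃ M : ℝ, ∀ N : ℕ, ‖z ^ N - l * q ^ N‖ ≤ M := by
    refine ⟨D + C + ‖f 0‖ + ‖β‖, fun N => ?_⟩
    have hqN : 0 ≤ q ^ N / b := by positivity
    have h1 := Nat.floor_le hqN
    have h2 := Nat.lt_floor_add_one (q ^ N / b)
    generalize ⌊q ^ N / b⌋₊ = n at h1 h2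
    rw [le_div_iff₀ hb0] at h1
    have h2' := h2
    rw [div_lt_iff₀ hb0] at h2'
    obtain ⟨x, hx, hx1, hx2⟩ := exists_posSpectrum_le_lt hq hqm (t := n * b) (by positivity)
    have h3 := hf (n * b) x hx ⟨by linarith, by linarith⟩
    have h4 := hC (n * b - x) ⟨by linarith, by linarith⟩
    have hXN := pow_mem_posSpectrum hm q N
    have h5 : ‖conjMap q z (q ^ N - x)‖ ≤ D :=
      hD ⟨_, ⟨sub_mem_mSpectrum hXN hx, by linarith, by nlinarith⟩, rfl⟩
    rw [conjMap_sub hconj (mSpectrum_subset_intRange _ (posSpectrum_subset hXN))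
      (mSpectrum_subset_intRange _ (posSpectrum_subset hx)), conjMap_pow hconj] at h5
    have h6 : ‖((q ^ N / b - n : ℝ) : ℂ) * β‖ ≤ ‖β‖ := by
      rw [norm_mul, Complex.norm_real]
      refine mul_le_of_le_one_left (norm_nonneg β) ?_
      rw [Real.norm_eq_abs, abs_le]
      rw [← le_div_iff₀ hb0] at h1
      constructor <;> linarith
    have h7 : z ^ N - l * q ^ N = (z ^ N - conjMap q z x) - F (n * b - x) + f 0
        - ((q ^ N / b - n : ℝ) : ℂ) * β := by
      rw [hmul] at h3
      push_cast
      rw [hl]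
      linear_combination -h3
    rw [h7]
    calc _ ≤ ‖z ^ N - conjMap q z x‖ + ‖F (n * b - x)‖ + ‖f 0‖
          + ‖((q ^ N / b - n : ℝ) : ℂ) * β‖ :=
          (norm_sub_le _ _).trans (add_le_add ((norm_add_le _ _).trans
            (add_le_add (norm_sub_le _ _) le_rfl)) le_rfl)
      _ ≤ _ := by linarith
  have hpos : 0 < ‖l * (z - q)‖ := norm_pos_iff.2 (mul_ne_zero hl0 (sub_ne_zero.2 hzq))
  obtain ⟨N, hN⟩ := pow_unbounded_of_one_lt ((M + ‖z‖ * M) / ‖l * (z - q)‖) hq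
  rw [div_lt_iff₀ hpos] at hN
  have h1 : (q : ℂ) ^ N * (l * (z - q)) =
      (z ^ (N + 1) - l * q ^ (N + 1)) - z * (z ^ N - l * q ^ N) := by ring
  have h2 : q ^ N * ‖l * (z - q)‖ ≤ M + ‖z‖ * M := by
    rw [← Real.norm_of_nonneg (pow_nonneg hq0.le N), ← Complex.norm_real, ← norm_mul,
      Complex.ofReal_pow, h1]
    refine (norm_sub_le _ _).trans (add_le_add (hM _) ?_)
    rw [norm_mul]
    exact mul_le_mul_of_nonneg_left (hM N) (norm_nonneg z)
  linarith

/-! ### Integrality, and the equivalence -/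

/-- `q` is an algebraic integer if its spectrum is locally finite: by finiteness, two of the
polynomials which govern the greedy orbit of `1` take the same value at `q`. -/
theorem isIntegral_of_finite {m : ℕ} {q : ℝ} (hm : 1 ≤ m) (hq : 1 < q) (hqm : q < m + 1)
    (hfin : ∀ R : ℝ, (mSpectrum m q ∩ Set.Icc (-R) R).Finite) : IsIntegral ℤ q := by
  have hq0 : 0 < q := by linarith
  have hq1 : 0 < q - 1 := by linarith
  obtain ⟨K, hK⟩ : ∃ K : ℝ, K = m / (q - 1) := ⟨_, rfl⟩
  have hK1 : 1 ≤ K := by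
    rw [hK, one_le_div hq1]
    linarith
  have hKq : q * K = K + m := by
    rw [hK]
    field_simp
    ring
  set T := greedyMap m q with hT
  have hmaps : Set.MapsTo T (mSpectrum m q ∩ Set.Icc 0 K) (mSpectrum m q ∩ Set.Icc 0 K) := by
    rintro d ⟨hd, hdK⟩
    refine ⟨?_, greedyMap_mapsTo hq0.le hKq hK1 hdK⟩
    have := mSpectrum_mul_add hd (s := -(greedyDigit m q d : ℤ))
      (by rw [abs_neg, Nat.abs_cast]; exact_mod_cast greedyDigit_le m q d)
    push_cast at this
    rwa [← sub_eq_add_neg] at this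
  have h1 : (1 : ℝ) ∈ mSpectrum m q ∩ Set.Icc 0 K :=
    ⟨one_mem_mSpectrum hm q, zero_le_one, hK1⟩
  have hpoly : ∀ n : ℕ, ∃ p : ℤ[X], p.degree = n ∧ p.Monic ∧ aeval q p = T^[n] 1 := by
    intro n
    induction n with
    | zero => exact ⟨1, by simp, monic_one, by simp⟩
    | succ n ih =>
      obtain ⟨p, hd, hp, hpq⟩ := ih
      have hlt : (C (greedyDigit m q (T^[n] 1) : ℤ) : ℤ[X]).degree < (X * p).degree := by
        refine lt_of_le_of_lt degree_C_le ?_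
        rw [degree_mul, degree_X, hd]
        exact_mod_cast Nat.succ_pos _ |>.trans_eq (add_comm n 1)
      refine ⟨X * p - C (greedyDigit m q (T^[n] 1) : ℤ), ?_, (monic_X.mul hp).sub_of_left hlt, ?_⟩
      · rw [degree_sub_eq_left_of_degree_lt hlt, degree_mul, degree_X, hd]
        push_cast
        exact add_comm _ _
      · rw [Function.iterate_succ_apply', ← hpq, hT, greedyMap]
        simp
  have hfin1 : (mSpectrum m q ∩ Set.Icc 0 K).Finite :=
    (hfin K).subset fun x hx => ⟨hx.1, by linarith [hx.2.1], hx.2.2⟩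
  obtain ⟨k, n, hkn, heq⟩ : ∃ k n : ℕ, k < n ∧ T^[k] 1 = T^[n] 1 := by
    by_contra hne
    push Not at hne
    refine (Set.infinite_of_injective_forall_mem (f := fun n => T^[n] 1) (fun k n h => ?_)
      (fun n => hmaps.iterate n h1)) hfin1
    rcases lt_trichotomy k n with h' | h' | h'
    · exact absurd h (hne k n h')
    · exact h'
    · exact absurd h.symm (hne n k h')
  obtain ⟨p, hpd, -, hp⟩ := hpoly k
  obtain ⟨r, hrd, hrm, hr⟩ := hpoly n
  refine ⟨r - p, hrm.sub_of_left (by rw [hpd, hrd]; exact_mod_cast hkn), ?_⟩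
  rw [← aeval_def, map_sub, hr, hp, heq, sub_self]

theorem sameRoots_of_minpoly {q : ℝ} {w : ℂ} (hq : IsIntegral ℚ q)
    (hw : aeval w (minpoly ℚ q) = 0) : SameRoots q w := by
  have hmin : minpoly ℚ w = minpoly ℚ q :=
    (minpoly.eq_of_irreducible_of_monic (minpoly.irreducible hq) hw (minpoly.monic hq)).symm
  intro p
  rw [← aeval_map_algebraMap ℚ q p, ← aeval_map_algebraMap ℚ w p, ← minpoly.dvd_iff,
    ← minpoly.dvd_iff, hmin]

theorem isPisot_of_finite {m : ℕ} {q : ℝ} (hm : 1 ≤ m) (hmq : m < q) (hqm : q < m + 1)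
    (hfin : ∀ R : ℝ, (mSpectrum m q ∩ Set.Icc (-R) R).Finite) : IsPisot q := by
  have hq : 1 < q := lt_of_le_of_lt (by exact_mod_cast hm) hmq
  have hint := isIntegral_of_finite hm hq hqm hfin
  refine ⟨hq, hint, fun w hw hwq => ?_⟩
  by_contra hnorm
  exact hwq (eq_of_finite_of_sameRoots hm hmq hqm
    (sameRoots_of_minpoly hint.tower_top hw) (not_lt.1 hnorm) hfin)

theorem isPisot_natCast {n : ℕ} (hn : 1 < n) : IsPisot (n : ℝ) := by
  refine ⟨by exact_mod_cast hn, isIntegral_natCast n, fun w hw hwn => absurd ?_ hwn⟩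
  rw [← map_natCast (algebraMap ℚ ℝ), minpoly.eq_X_sub_C] at hw
  simp only [map_natCast, map_sub, aeval_X, sub_eq_zero] at hw
  simpa using hw

theorem theorem1p1 (q : ℝ) (hq : 1 < q) (m : ℕ) (hm : 1 ≤ m) :
    (¬ ∃ x : ℝ, AccPt x (Filter.principal (mSpectrum m q))) ↔
      (IsPisot q ∨ (m : ℝ) + 1 ≤ q) := by
  constructor
  · intro h
    by_cases hqm : (m : ℝ) + 1 ≤ q
    · exact Or.inr hqm
    push Not at hqm
    refine Or.inl ?_
    have hq0 : 0 ≤ q := by linarith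
    have h1 := Nat.floor_le hq0
    have h2 := Nat.lt_floor_add_one q
    have h3 : 1 ≤ ⌊q⌋₊ := Nat.le_floor (by simpa using hq.le)
    have h4 : ⌊q⌋₊ ≤ m := Nat.lt_succ_iff.1 ((Nat.floor_lt hq0).2 (by push_cast; exact hqm))
    rcases h1.eq_or_lt with h5 | h5
    · rw [← h5] at hq ⊢
      exact isPisot_natCast (by exact_mod_cast hq)
    -- passing to the height `⌊q⌋` gives `m < q < m + 1`
    · exact isPisot_of_finite h3 h5 h2 fun R =>
        (finite_inter_Icc_of_not_accPt h R).subset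
          (Set.inter_subset_inter_left _ (mSpectrum_mono h4 q))
  · rintro (h | h)
    · exact not_accPt_of_finite_inter_Icc (finite_mSpectrum_inter_of_isPisot h)
    · exact not_accPt_of_finite_inter_Icc (finite_mSpectrum_inter_of_add_one_le hm h)
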